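/- Let $d\ge 1$ and $\alpha\in(0,2]$, and let $|\cdot|$ be the Euclidean norm on $\mathbb{R}^d$. Let $F$ be a probability distribution on $\mathbb{R}^d$ in the domain of attraction without centering of a nondegenerate stable law of exponent $\alpha$ (written $F\in\mathcal{D}'_0(\alpha)$): for $X,X_1,X_2,\dots$ i.i.d. $\sim F$ and $S_n=X_1+\dots+X_n$, $S_0=0$, there are real $b_n\to\infty$ such that $S_n/b_n$ converges weakly to a stable law of exponent $\alpha$ that is not concentrated on an affine hyperplane. Let $V(s)=\mathbb{E}[|X|^2\mathbf 1\{|X|\le s\}]$, and let $A$ be a strictly increasing smooth function on $[0,\infty)$ with $A(0)=0$, with $c_1A(s)/s\le A'(s)\le c_2A(s)/s$ for all $s>0$ for some constants $c_1,c_2>0$, and with $A(s)=[1+o(1)]\,s^2/V(s)\to\infty$ as $s\to\infty$. Put $a_0=1$ and $a_n=A^{-1}(n)$ for $n\ge1$. Let $I_d=[0,1)^d$, $|X_{0:1}|=0$ and $|X_{n:1}|=\max_{1\le i\le n}|X_i|$ for $n\ge 1$. Then there are $s_0>0$ and $C>0$, both depending only on $F$ and $A$, and for each $h>0$ a constant $K_h>0$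 depending only on $F$, $A$ and $h$, such that for all $x\in\mathbb{R}^d$, $s\ge s_0$, $h>0$ and $n\ge0$, \[ \mathbb{P}\bigl(S_n\in x+hI_d,\ |X_{n:1}|\le s\bigr)\le K_h\,(s^{-d}+a_n^{-d})\exp\bigl(-|x|/s+Cn/A(s)\bigr). \] In particular, for all $h>0$ and $n\ge 0$, the L\'evy concentration function satisfies \[ Q_{S_n}(h):=\sup_{x\in\mathbb{R}^d}\mathbb{P}(S_n\in x+hI_d)\le K_h\,a_n^{-d}. \] -/

import Mathlib

open MeasureTheory ProbabilityTheory Filter Set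
open scoped Topology Asymptotics RealInnerProductSpace

noncomputable section

namespace LocalLDP

/-- `S_n(x) = x_1 + ... + x_n`, with `S_0(x) = 0`. A sequence `x_1, x_2, ...` is coded as
`x 0, x 1, ...`, so that `x i` stands for the term with index `i + 1`. -/
def partialSum {E : Type*} [AddCommMonoid E] (x : ℕ → E) (n : ℕ) : E :=
  ∑ i ∈ Finset.range n, x i

/-- The running maximum `|x_{n:1}| = max (|x_1|, ..., |x_n|)`, with `|x_{0:1}| = 0`. -/
def runningMax {E : Type*} [Norm E] (x : ℕ → E) : ℕ → ℝ
  | 0 => 0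
  | n + 1 => max (runningMax x n) ‖x n‖

/-- The unit cell `I_d = [0,1)^d`. -/
def unitCell (d : ℕ) : Set (EuclideanSpace ℝ (Fin d)) :=
  {y | ∀ i, 0 ≤ y i ∧ y i < 1}

/-- The set `x + h I_d`. -/
def cell {d : ℕ} (x : EuclideanSpace ℝ (Fin d)) (h : ℝ) : Set (EuclideanSpace ℝ (Fin d)) :=
  (fun y => x + h • y) '' unitCell d

/-- The Lévy concentration function `Q_Y(h) = sup_x P(Y ∈ x + h I_d)`. The supremum is over a
nonempty family of reals bounded by `1` when `P` is a probability measure. -/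
def levyConcentration {d : ℕ} {Ω : Type*} [MeasurableSpace Ω] (P : Measure Ω)
    (Y : Ω → EuclideanSpace ℝ (Fin d)) (h : ℝ) : ℝ :=
  ⨆ x : EuclideanSpace ℝ (Fin d), P.real {ω | Y ω ∈ cell x h}

/-- A law on `ℝ^d` is nondegenerate if it is not concentrated on an affine hyperplane. -/
def IsNondegenerate {d : ℕ} (μ : Measure (EuclideanSpace ℝ (Fin d))) : Prop :=
  ∀ u : EuclideanSpace ℝ (Fin d), u ≠ 0 → ∀ c : ℝ, ¬ ∀ᵐ x ∂μ, ⟪u, x⟫ = c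

/-- A law `μ` is stable with exponent `α`: if `Y, Y'` are independent with law `μ`, then for all
`a, b > 0` the variable `a Y + b Y'` has the law of `(a^α + b^α)^{1/α} Y + c` for some vector
`c`. -/
def IsStableLaw {d : ℕ} (α : ℝ) (μ : Measure (EuclideanSpace ℝ (Fin d))) : Prop :=
  ∀ a b : ℝ, 0 < a → 0 < b → ∃ c : EuclideanSpace ℝ (Fin d),
    (μ.prod μ).map (fun p => a • p.1 + b • p.2) =
      μ.map (fun y => ((a ^ α + b ^ α) ^ (1 / α)) • y + c)

/-- `F` is in the domain of attraction without centering of a nondegenerate stable law of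
exponent `α`: for some reals `b_n → ∞`, the variables `S_n / b_n` converge weakly to such a law.
The i.i.d. sequence with law `F` is realised as the coordinates of the infinite product. -/
def InDomainOfAttractionWithoutCentering {d : ℕ} (α : ℝ)
    (F : Measure (EuclideanSpace ℝ (Fin d))) [IsProbabilityMeasure F] : Prop :=
  ∃ b : ℕ → ℝ, Tendsto b atTop atTop ∧
    ∃ (G : Measure (EuclideanSpace ℝ (Fin d))) (_ : IsProbabilityMeasure G),
      IsStableLaw α G ∧ IsNondegenerate G ∧
      TendstoInDistribution
        (fun n (y : ℕ → EuclideanSpace ℝ (Fin d)) => (b n)⁻¹ • partialSum y n) atTop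
        (id : EuclideanSpace ℝ (Fin d) → EuclideanSpace ℝ (Fin d))
        (fun _ => Measure.infinitePi (fun _ : ℕ => F)) G

/-- The truncated second moment `V(s) = E[|X|^2; |X| ≤ s]` of `X ∼ F`. -/
def truncSecondMoment {d : ℕ} (F : Measure (EuclideanSpace ℝ (Fin d))) (s : ℝ) : ℝ :=
  ∫ x in {x | ‖x‖ ≤ s}, ‖x‖ ^ 2 ∂F

/-- `A` is an admissible scaling function for `F`: smooth and strictly increasing on `[0, ∞)`
with `A(0) = 0`, `A'(s) ≍ A(s)/s` for `s > 0`, and `A(s) = [1 + o(1)] s^2 / V(s) → ∞` as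
`s → ∞`. Values of `A` on the negative axis play no role. -/
structure IsScalingFunction {d : ℕ} (F : Measure (EuclideanSpace ℝ (Fin d))) (A : ℝ → ℝ) :
    Prop where
  strictMonoOn : StrictMonoOn A (Ici 0)
  contDiffOn : ContDiffOn ℝ (⊤ : ℕ∞) A (Ici 0)
  map_zero : A 0 = 0
  deriv_asymp : ∃ c₁ c₂ : ℝ, 0 < c₁ ∧ 0 < c₂ ∧
    ∀ s, 0 < s → c₁ * (A s / s) ≤ deriv A s ∧ deriv A s ≤ c₂ * (A s / s)
  isEquivalent : A ~[atTop] fun s => s ^ 2 / truncSecondMoment F s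
  tendsto_atTop : Tendsto A atTop atTop

/-- The scaling constants `a_n = A⁻¹(n)` for `n ≥ 1`, the inverse being that of `A` on
`[0, ∞)`, and `a_0 = 1`. -/
def scalingSeq (A : ℝ → ℝ) (n : ℕ) : ℝ :=
  if n = 0 then 1 else Function.invFunOn A (Ici 0) n

end LocalLDP

end

/-!
The probability of the event `S_n ∈ x + h I_d`, `max |X_i| ≤ s` is bounded by an exponential change
of measure followed by a smoothing inequality.

Let `u` be the unit vector along `x`. Each term is truncated at `s` and weighted by
`exp (⟪X_i, u⟫ / s)`. On the event the product of the weights is at least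
`exp ((‖x‖ - h √d) / s)`, which produces the factor `exp (-‖x‖ / s)`
(`measureReal_pi_le_tiltedSum`). Let `ν` be the weighted law. Its mass is
`1 + O(‖E[X; |X| ≤ s]‖ / s + V(s) / s²) = exp (O(1 / A(s)))`. The Esseen type inequality
`measureReal_closedBall_le` bounds the remaining probability by the integral of `‖ν̂‖ ^ n` over a
ball of frequencies. For `‖θ‖ ≥ R / s` the bound `‖ν̂(θ)‖ ≤ ν(ℝ^d) exp (-c / A(1 / ‖θ‖))` holds,
and by the growth of `A` the integral of `exp (-c n / A(1 / ‖θ‖))` is `O(a_n ^ (-d))`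
(`IsScalingFunction.exists_integral_exp_le`). The frequencies with `‖θ‖ ≤ R / s` contribute
`O(s ^ (-d))`. The bound for the concentration function follows by letting `s → ∞`.

The input from the domain of attraction, `InDomainOfAttractionWithoutCentering.exists_bounds`,
consists of `1 - ‖φ(θ)‖ ≥ c / A(1 / ‖θ‖)` near the origin and
`‖E[X; |X| ≤ s]‖ ≤ C s / A(s)`, where `φ` is the characteristic function of `F`. Both come from the
locally uniform convergence `φ(θ / b_n) ^ n → ψ(θ)`, where `ψ` is the characteristic function of the
stable limit. Stability and nondegeneracy give `‖ψ‖ < 1` off the origin, hence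
`1 - ‖φ(θ / b_n)‖ ≥ ε / n` on annuli. A continuity argument for the logarithm gives
`φ(θ / b_n) = 1 + O(1 / n)` near the origin, hence bounds for `V(b_n)` and for the truncated mean.
Together with the tail bound `P(|X| > s) = O(1 / A(s))`, which follows from the growth of `A`
alone, these give that `A(b_n)` has exact order `n`, so that the levels `b_n` meet every scale up to
a bounded factor.
-/

namespace LocalLDP

/-! ### Growth of the scaling function -/

section Growth

variable {d : ℕ} {F : Measure (EuclideanSpace ℝ (Fin d))} {A : ℝ → ℝ}

lemma IsScalingFunction.pos (hA : IsScalingFunction F A) {s : ℝ} (hs : 0 < s) : 0 < A s := by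
  have := hA.strictMonoOn (mem_Ici.2 le_rfl) (mem_Ici.2 hs.le) hs
  rwa [hA.map_zero] at this

lemma IsScalingFunction.mono (hA : IsScalingFunction F A) {s t : ℝ} (hs : 0 ≤ s) (hst : s ≤ t) :
    A s ≤ A t :=
  hA.strictMonoOn.monotoneOn (mem_Ici.2 hs) (mem_Ici.2 (hs.trans hst)) hst

lemma IsScalingFunction.hasDerivAt (hA : IsScalingFunction F A) {s : ℝ} (hs : 0 < s) :
    HasDerivAt A (deriv A s) s :=
  ((hA.contDiffOn.differentiableOn (by simp) s hs.le).differentiableAt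
    (Ici_mem_nhds hs)).hasDerivAt

lemma IsScalingFunction.hasDerivAt_mul_rpow (hA : IsScalingFunction F A) (κ : ℝ) {s : ℝ}
    (hs : 0 < s) :
    HasDerivAt (fun s => A s * s ^ (-κ)) ((deriv A s - κ * (A s / s)) * s ^ (-κ)) s := by
  have h := (hA.hasDerivAt hs).mul (Real.hasDerivAt_rpow_const (p := -κ) (Or.inl hs.ne'))
  convert! h using 1
  rw [Real.rpow_sub_one hs.ne']
  ring

/-- The lower bound on the logarithmic derivative makes `A s / s ^ κ` increasing. -/
lemma IsScalingFunction.exists_rpow_mul_le (hA : IsScalingFunction F A) :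
    ∃ κ : ℝ, 0 < κ ∧ ∀ s l : ℝ, 0 < s → 1 ≤ l → l ^ κ * A s ≤ A (l * s) := by
  obtain ⟨c₁, c₂, h₁, -, h⟩ := hA.deriv_asymp
  refine ⟨c₁, h₁, fun s l hs hl => ?_⟩
  have hmono : MonotoneOn (fun s => A s * s ^ (-c₁)) (Ioi 0) := by
    refine monotoneOn_of_deriv_nonneg (convex_Ioi 0)
      (fun x hx => (hA.hasDerivAt_mul_rpow c₁ hx).continuousAt.continuousWithinAt)
      (fun x hx => ?_) fun x hx => ?_
    · rw [interior_Ioi] at hx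
      exact (hA.hasDerivAt_mul_rpow c₁ hx).differentiableAt.differentiableWithinAt
    · rw [interior_Ioi] at hx
      rw [(hA.hasDerivAt_mul_rpow c₁ hx).deriv]
      exact mul_nonneg (sub_nonneg.2 (h x hx).1) (Real.rpow_nonneg (le_of_lt hx) _)
  have hl0 : 0 < l := by linarith
  have hle := hmono (mem_Ioi.2 hs) (mem_Ioi.2 (mul_pos hl0 hs)) (le_mul_of_one_le_left hs.le hl)
  simp only [Real.mul_rpow hl0.le hs.le] at hle
  have hsp := Real.rpow_pos_of_pos hs (-c₁)
  rw [← mul_assoc, mul_le_mul_iff_left₀ hsp, Real.rpow_neg hl0.le,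
    le_mul_inv_iff₀ (Real.rpow_pos_of_pos hl0 _)] at hle
  linarith

/-- The upper bound on the logarithmic derivative makes `A s / s ^ κ` decreasing. -/
lemma IsScalingFunction.exists_le_rpow_mul (hA : IsScalingFunction F A) :
    ∃ κ : ℝ, 0 < κ ∧ ∀ s l : ℝ, 0 < s → 1 ≤ l → A (l * s) ≤ l ^ κ * A s := by
  obtain ⟨c₁, c₂, -, h₂, h⟩ := hA.deriv_asymp
  refine ⟨c₂, h₂, fun s l hs hl => ?_⟩
  have hanti : AntitoneOn (fun s => A s * s ^ (-c₂)) (Ioi 0) := by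
    refine antitoneOn_of_deriv_nonpos (convex_Ioi 0)
      (fun x hx => (hA.hasDerivAt_mul_rpow c₂ hx).continuousAt.continuousWithinAt)
      (fun x hx => ?_) fun x hx => ?_
    · rw [interior_Ioi] at hx
      exact (hA.hasDerivAt_mul_rpow c₂ hx).differentiableAt.differentiableWithinAt
    · rw [interior_Ioi] at hx
      rw [(hA.hasDerivAt_mul_rpow c₂ hx).deriv]
      exact mul_nonpos_of_nonpos_of_nonneg (sub_nonpos.2 (h x hx).2)
        (Real.rpow_nonneg (le_of_lt hx) _)
  have hl0 : 0 < l := by linarith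
  have hle := hanti (mem_Ioi.2 hs) (mem_Ioi.2 (mul_pos hl0 hs)) (le_mul_of_one_le_left hs.le hl)
  simp only [Real.mul_rpow hl0.le hs.le] at hle
  have hsp := Real.rpow_pos_of_pos hs (-c₂)
  rw [← mul_assoc, mul_le_mul_iff_left₀ hsp, Real.rpow_neg hl0.le,
    mul_inv_le_iff₀ (Real.rpow_pos_of_pos hl0 _)] at hle
  linarith

lemma IsScalingFunction.scalingSeq_spec (hA : IsScalingFunction F A) {n : ℕ} (hn : n ≠ 0) :
    0 < scalingSeq A n ∧ A (scalingSeq A n) = n := by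
  have hex : ∃ a ∈ Ici (0 : ℝ), A a = n := by
    obtain ⟨t, ht0, ht⟩ :=
      ((eventually_ge_atTop (0 : ℝ)).and (hA.tendsto_atTop.eventually_ge_atTop (n : ℝ))).exists
    have := intermediate_value_Icc ht0 (hA.contDiffOn.continuousOn.mono Icc_subset_Ici_self)
    obtain ⟨a, ha, hav⟩ := this ⟨by rw [hA.map_zero]; positivity, ht⟩
    exact ⟨a, ha.1, hav⟩
  have h1 := Function.invFunOn_mem hex
  have h2 := Function.invFunOn_eq hex
  have hs : scalingSeq A n = Function.invFunOn A (Ici 0) n := if_neg hn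
  rw [hs]
  refine ⟨lt_of_le_of_ne h1 fun h0 => ?_, h2⟩
  rw [← h0, hA.map_zero] at h2
  exact hn (by exact_mod_cast h2.symm)

lemma IsScalingFunction.scalingSeq_pos (hA : IsScalingFunction F A) (n : ℕ) :
    0 < scalingSeq A n := by
  rcases eq_or_ne n 0 with rfl | hn
  · simp [scalingSeq]
  · exact (hA.scalingSeq_spec hn).1

/-- `A(s) V(s)` is comparable to `s²`. -/
lemma IsScalingFunction.exists_mul_truncSecondMoment (hA : IsScalingFunction F A) :
    ∃ s₁ : ℝ, 0 < s₁ ∧ ∀ s, s₁ ≤ s → s ^ 2 / 2 ≤ A s * truncSecondMoment F s ∧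
      A s * truncSecondMoment F s ≤ 2 * s ^ 2 := by
  obtain ⟨φ, hφ, hA'⟩ := hA.isEquivalent.exists_eq_mul
  have h1 : ∀ᶠ s in atTop, φ s ∈ Icc (1 / 2 : ℝ) 2 :=
    hφ.eventually (Icc_mem_nhds (by norm_num) (by norm_num))
  obtain ⟨t, ht⟩ := (h1.and (hA'.and (eventually_gt_atTop (0 : ℝ)))).exists_forall_of_atTop
  refine ⟨max t 1, by positivity, fun s hs => ?_⟩
  obtain ⟨hφs, hAs, hs0⟩ := ht s ((le_max_left _ _).trans hs)
  have hV : truncSecondMoment F s ≠ 0 := by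
    intro h0
    have := hA.pos hs0
    rw [hAs] at this
    simp [h0] at this
  have : A s * truncSecondMoment F s = φ s * s ^ 2 := by
    rw [hAs]
    simp only [Pi.mul_apply]
    field_simp
  rw [this]
  constructor <;> nlinarith [hφs.1, hφs.2, sq_nonneg s]

end Growth

/-! ### Tails -/

section Tails

variable {d : ℕ} {F : Measure (EuclideanSpace ℝ (Fin d))} [IsProbabilityMeasure F] {A : ℝ → ℝ}

lemma measurableSet_norm_le (s : ℝ) :
    MeasurableSet {x : EuclideanSpace ℝ (Fin d) | ‖x‖ ≤ s} :=
  measurableSet_le measurable_norm measurable_const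

/-- Feller's tail bound. The growth of `A` gives `P(s < |X| ≤ 2 s) = O(1 / A(s))`, and the sum of
these bounds along `s, 2 s, 4 s, ...` is geometric. -/
lemma IsScalingFunction.exists_tail_le (hA : IsScalingFunction F A) :
    ∃ C s₁ : ℝ, 0 < C ∧ 0 < s₁ ∧ ∀ s, s₁ ≤ s → F.real {x | s < ‖x‖} ≤ C / A s := by
  obtain ⟨κ, hκ, hgrow⟩ := hA.exists_rpow_mul_le
  obtain ⟨s₁, hs₁, hV⟩ := hA.exists_mul_truncSecondMoment
  set q : ℝ := 2 ^ (-κ) with hq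
  have hq0 : 0 < q := Real.rpow_pos_of_pos two_pos _
  have hq1 : q < 1 := Real.rpow_lt_one_of_one_lt_of_neg one_lt_two (by linarith)
  have hAq : ∀ s, 0 < s → 1 / A (2 * s) ≤ q / A s := fun s hs => by
    have h := hgrow s 2 hs one_le_two
    have h2 : (0 : ℝ) < 2 ^ κ := Real.rpow_pos_of_pos two_pos _
    rw [hq, Real.rpow_neg two_pos.le, div_le_div_iff₀ (hA.pos (by linarith)) (hA.pos hs),
      one_mul, inv_mul_eq_div, le_div_iff₀ h2]
    linarith
  have hstep : ∀ s, s₁ ≤ s → F.real {x | s < ‖x‖} ≤ F.real {x | 2 * s < ‖x‖} + 8 * q / A s := by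
    intro s hs
    have hs0 : 0 < s := hs₁.trans_le hs
    have hsub : {x : EuclideanSpace ℝ (Fin d) | s < ‖x‖} ⊆
        {x | 2 * s < ‖x‖} ∪ {x | s ^ 2 ≤ ({x | ‖x‖ ≤ 2 * s} : Set _).indicator
          (fun x => ‖x‖ ^ 2) x} := by
      intro x hx
      rcases lt_or_ge (2 * s) ‖x‖ with h | h
      · exact Or.inl h
      · right
        simp only [mem_ofPred_eq, indicator_of_mem (show x ∈ {x | ‖x‖ ≤ 2 * s} from h)]
        exact pow_le_pow_left₀ hs0.le (le_of_lt hx) 2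
    have hint : Integrable (({x | ‖x‖ ≤ 2 * s} : Set (EuclideanSpace ℝ (Fin d))).indicator
        (fun x => ‖x‖ ^ 2)) F := by
      refine Integrable.of_bound (C := (2 * s) ^ 2)
        ((by fun_prop : Measurable fun x : EuclideanSpace ℝ (Fin d) => ‖x‖ ^ 2).indicator
          (measurableSet_norm_le _)).aestronglyMeasurable (ae_of_all _ fun x => ?_)
      by_cases h : ‖x‖ ≤ 2 * s
      · rw [indicator_of_mem (show x ∈ {x | ‖x‖ ≤ 2 * s} from h),
          Real.norm_of_nonneg (by positivity)]
        exact pow_le_pow_left₀ (norm_nonneg _) h 2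
      · rw [indicator_of_notMem (show x ∉ {x | ‖x‖ ≤ 2 * s} from h)]
        simp only [norm_zero]; positivity
    have hmarkov := mul_meas_ge_le_integral_of_nonneg
      (ae_of_all F fun x => indicator_nonneg (s := {x | ‖x‖ ≤ 2 * s})
        (f := fun x : EuclideanSpace ℝ (Fin d) => ‖x‖ ^ 2) (fun x _ => by positivity) x)
      hint (s ^ 2)
    rw [integral_indicator (measurableSet_norm_le _)] at hmarkov
    have hV2 := (hV (2 * s) (by linarith)).2
    have hA2 := hA.pos (show 0 < 2 * s by linarith)
    have h8 : F.real {x | s ^ 2 ≤ ({x | ‖x‖ ≤ 2 * s} : Set _).indicator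
          (fun x => ‖x‖ ^ 2) x} ≤ 8 * (1 / A (2 * s)) := by
      rw [mul_one_div, le_div_iff₀ hA2]
      have hs2 : 0 < s ^ 2 := by positivity
      change s ^ 2 * _ ≤ truncSecondMoment F (2 * s) at hmarkov
      refine le_of_mul_le_mul_left ?_ hs2
      nlinarith [mul_le_mul_of_nonneg_right hmarkov hA2.le]
    calc F.real {x | s < ‖x‖} ≤ _ := measureReal_mono hsub
      _ ≤ _ := measureReal_union_le _ _
      _ ≤ _ := by
        have := hAq s hs0
        have h3 : 8 * q / A s = 8 * (q / A s) := by ring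
        rw [h3]; linarith
  set C : ℝ := 8 * q / (1 - q) with hC
  have hC0 : 0 < C := by have : 0 < 1 - q := by linarith
                         positivity
  have hiter : ∀ (k : ℕ) (s : ℝ), s₁ ≤ s →
      F.real {x | s < ‖x‖} ≤ F.real {x | 2 ^ k * s < ‖x‖} + C / A s := by
    intro k
    induction k with
    | zero =>
      intro s hs
      have := hA.pos (hs₁.trans_le hs)
      simp only [pow_zero, one_mul, le_add_iff_nonneg_right]; positivity
    | succ k ih =>
      intro s hs
      have hs0 := hs₁.trans_le hs
      have h1 := ih (2 * s) (by linarith)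
      have h2 := hstep s hs
      have h3 : C / A (2 * s) ≤ C * (q / A s) := by
        rw [div_eq_mul_one_div]
        exact mul_le_mul_of_nonneg_left (hAq s hs0) hC0.le
      have h4 : C * (q / A s) + 8 * q / A s = C / A s := by
        have : (1 - q) ≠ 0 := by linarith
        have := (hA.pos hs0).ne'
        rw [hC]; field_simp; ring
      rw [← mul_assoc, ← pow_succ] at h1
      linarith
  refine ⟨C, s₁, hC0, hs₁, fun s hs => ?_⟩
  have hs0 := hs₁.trans_le hs
  have htend : Tendsto (fun k : ℕ => F.real {x | (2 : ℝ) ^ k * s < ‖x‖}) atTop (𝓝 0) := by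
    have hT : Tendsto (fun r : ℝ => F {x | r < ‖x‖}) atTop (𝓝 0) := by
      have := tendsto_measure_norm_gt_of_isTightMeasureSet
        (isTightMeasureSet_singleton (μ := F))
      simpa using this
    have := (hT.comp ((tendsto_pow_atTop_atTop_of_one_lt one_lt_two).atTop_mul_const hs0))
    exact (ENNReal.tendsto_toReal ENNReal.zero_ne_top).comp this
  have := ge_of_tendsto' (htend.add_const (C / A s)) fun k => hiter k s hs
  simpa using this

end Tails

/-! ### Characteristic functions -/

section CharFun

variable {E : Type*} [NormedAddCommGroup E] [InnerProductSpace ℝ E] [MeasurableSpace E]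
  [BorelSpace E] [SecondCountableTopology E]

lemma integrable_cos_inner_sub (μ : Measure E) [IsFiniteMeasure μ] (θ : E) (β : ℝ) :
    Integrable (fun x => Real.cos (⟪x, θ⟫ - β)) μ :=
  Integrable.of_bound (by fun_prop) 1 (ae_of_all _ fun x => Real.abs_cos_le_one _)

lemma re_exp_mul_charFun (μ : Measure E) [IsFiniteMeasure μ] (θ : E) (β : ℝ) :
    (Complex.exp (-β * Complex.I) * charFun μ θ).re = ∫ x, Real.cos (⟪x, θ⟫ - β) ∂μ := by
  have hint : Integrable (fun x => Complex.exp (-β * Complex.I) *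
      Complex.exp ((⟪x, θ⟫ : ℝ) * Complex.I)) μ :=
    (Integrable.of_bound (by fun_prop) 1
      (ae_of_all _ fun x => by rw [Complex.norm_exp_ofReal_mul_I])).const_mul _
  rw [charFun_apply, ← integral_const_mul]
  have := (integral_re hint)
  simp only [RCLike.re_to_complex] at this
  rw [← this]
  congr with x
  rw [← Complex.exp_add, ← Complex.exp_ofReal_mul_I_re]
  congr 2
  push_cast
  ring

lemma integral_cos_le_norm_charFun (μ : Measure E) [IsFiniteMeasure μ] (θ : E) (β : ℝ) :
    ∫ x, Real.cos (⟪x, θ⟫ - β) ∂μ ≤ ‖charFun μ θ‖ := by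
  rw [← re_exp_mul_charFun]
  refine (Complex.re_le_norm _).trans ?_
  rw [norm_mul, ← Complex.ofReal_neg, Complex.norm_exp_ofReal_mul_I, one_mul]

/-- The modulus of a characteristic function is the integral of a shifted cosine, the shift being
the argument. -/
lemma exists_norm_charFun_eq (μ : Measure E) [IsFiniteMeasure μ] (θ : E) :
    ∃ β : ℝ, ‖charFun μ θ‖ = ∫ x, Real.cos (⟪x, θ⟫ - β) ∂μ := by
  refine ⟨(charFun μ θ).arg, ?_⟩
  rw [← re_exp_mul_charFun]
  nth_rewrite 3 [← Complex.norm_mul_exp_arg_mul_I (charFun μ θ)]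
  rw [mul_left_comm, ← Complex.exp_add]
  simp

/-- If the characteristic function of a probability measure has modulus `1` at `θ`, then `⟪x, θ⟫`
lies almost surely in a translate of `2πℤ`. -/
lemma exists_ae_cos_eq_one {μ : Measure E} [IsProbabilityMeasure μ] {θ : E}
    (h : ‖charFun μ θ‖ = 1) : ∃ β : ℝ, ∀ᵐ x ∂μ, Real.cos (⟪x, θ⟫ - β) = 1 := by
  obtain ⟨β, hβ⟩ := exists_norm_charFun_eq μ θ
  refine ⟨β, ?_⟩
  have hint := integrable_cos_inner_sub μ θ β
  have h0 : ∫ x, (1 - Real.cos (⟪x, θ⟫ - β)) ∂μ = 0 := by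
    rw [integral_sub (integrable_const _) hint, ← hβ, h]
    simp
  rw [integral_eq_zero_iff_of_nonneg (fun x => sub_nonneg.2 (Real.cos_le_one _))
    ((integrable_const _).sub hint)] at h0
  filter_upwards [h0] with x hx
  simp only [Pi.zero_apply] at hx
  linarith

lemma integral_innerProbChar_map_inner {Ω : Type*} [MeasurableSpace Ω] (P : Measure Ω)
    {Y : Ω → E} (hY : AEMeasurable Y P) (θ : E) :
    ∫ v, BoundedContinuousFunction.innerProbChar (1 : ℝ) v ∂(P.map fun ω => (⟪Y ω, θ⟫ : ℝ)) =
      charFun (P.map Y) θ := by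
  rw [← charFun_eq_integral_innerProbChar, charFun_apply, charFun_apply,
    integral_map (by fun_prop) (by fun_prop), integral_map hY (by fun_prop)]
  simp

/-- Continuity of the characteristic function of the weak limit holds jointly in the index and the
argument; hence the characteristic functions converge uniformly on compact sets. -/
lemma tendstoLocallyUniformly_charFun {Ω Ω' : Type*} [MeasurableSpace Ω] [MeasurableSpace Ω']
    {P : Measure Ω} [IsProbabilityMeasure P] {P' : Measure Ω'} [IsProbabilityMeasure P']
    {Y : ℕ → Ω → E} {Z : Ω' → E} (h : TendstoInDistribution Y atTop Z (fun _ => P) P') :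
    TendstoLocallyUniformly (fun n θ => charFun (P.map (Y n)) θ) (charFun (P'.map Z)) atTop := by
  rw [tendstoLocallyUniformly_iff_forall_tendsto]
  intro θ
  have hcomp : TendstoInDistribution (fun p : ℕ × E => Y p.1) (atTop ×ˢ 𝓝 θ) Z
      (fun _ => P) P' :=
    ⟨fun p => h.forall_aemeasurable p.1, h.aemeasurable_limit, h.tendsto.comp tendsto_fst⟩
  have hconst : TendstoInMeasure P (fun (p : ℕ × E) (_ : Ω) => p.2) (atTop ×ˢ 𝓝 θ)
      (fun _ => θ) := by
    rw [tendstoInMeasure_iff_norm]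
    intro ε hε
    refine tendsto_const_nhds.congr' ?_
    have : ∀ᶠ p : ℕ × E in atTop ×ˢ 𝓝 θ, dist p.2 θ < ε :=
      tendsto_snd.eventually (Metric.ball_mem_nhds θ hε)
    filter_upwards [this] with p hp
    rw [dist_eq_norm] at hp
    simp [hp.not_ge]
  have hinner := hcomp.continuous_comp_prodMk_of_tendstoInMeasure_const
    (g := fun p : E × E => (⟪p.1, p.2⟫ : ℝ)) (by fun_prop) hconst (fun _ => aemeasurable_const)
  have hchar := (ProbabilityMeasure.tendsto_iff_forall_integral_rclike_tendsto ℂ).1 hinner.tendsto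
  have h1 := hchar (BoundedContinuousFunction.innerProbChar (1 : ℝ))
  simp only [ProbabilityMeasure.coe_mk] at h1
  rw [integral_innerProbChar_map_inner P' h.aemeasurable_limit] at h1
  have h2 : Tendsto (fun p : ℕ × E => charFun (P.map (Y p.1)) p.2) (atTop ×ˢ 𝓝 θ)
      (𝓝 (charFun (P'.map Z) θ)) :=
    h1.congr fun p => integral_innerProbChar_map_inner P (h.forall_aemeasurable p.1) p.2
  have : IsProbabilityMeasure (P'.map Z) := Measure.isProbabilityMeasure_map h.aemeasurable_limit
  have h3 : Tendsto (fun p : ℕ × E => charFun (P'.map Z) p.2) (atTop ×ˢ 𝓝 θ)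
      (𝓝 (charFun (P'.map Z) θ)) :=
    (continuous_charFun.tendsto θ).comp tendsto_snd
  exact (h3.prodMk_nhds h2).mono_right (nhds_le_uniformity _)

end CharFun

/-! ### The limit law -/

section Limit

variable {d : ℕ} {α : ℝ} {F G : Measure (EuclideanSpace ℝ (Fin d))} [IsProbabilityMeasure F]
  [IsProbabilityMeasure G]

lemma charFun_map_partialSum (b : ℝ) (n : ℕ) (θ : EuclideanSpace ℝ (Fin d)) :
    charFun ((Measure.infinitePi (fun _ : ℕ => F)).map
      (fun y => b⁻¹ • partialSum y n)) θ = charFun F (b⁻¹ • θ) ^ n := by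
  rw [charFun_map_smul_comp (f := fun y => partialSum y n)
    (by unfold partialSum; fun_prop)]
  have hind : iIndepFun (fun (i : ℕ) (y : ℕ → EuclideanSpace ℝ (Fin d)) => y i)
      (Measure.infinitePi (fun _ : ℕ => F)) :=
    iIndepFun_infinitePi (X := fun _ x => x) (fun _ => measurable_id)
  unfold partialSum
  rw [iIndepFun.charFun_map_fun_finsetSum_eq_prod (fun i _ => (measurable_pi_apply i).aemeasurable)
    (hind.restrict (Finset.range n))]
  simp [Measure.infinitePi_map_eval]

lemma IsStableLaw.norm_charFun_sq (hG : IsStableLaw α G) (θ : EuclideanSpace ℝ (Fin d)) :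
    ‖charFun G θ‖ ^ 2 = ‖charFun G ((2 : ℝ) ^ (1 / α) • θ)‖ := by
  obtain ⟨c, hc⟩ := hG 1 1 one_pos one_pos
  have h := congrArg (fun μ => charFun μ θ) hc
  simp only [one_smul, Real.one_rpow, one_add_one_eq_two] at h
  rw [charFun_map_add_prod_eq_mul,
    show (fun y : EuclideanSpace ℝ (Fin d) => (2 : ℝ) ^ (1 / α) • y + c) =
      (fun y => y + c) ∘ (fun y => (2 : ℝ) ^ (1 / α) • y) from rfl,
    ← Measure.map_map (by fun_prop) (by fun_prop), charFun_map_add_const, charFun_map_smul] at h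
  have h' := congrArg norm h
  rw [Pi.mul_apply, norm_mul, norm_mul, Complex.norm_exp_ofReal_mul_I, mul_one] at h'
  rw [sq, h']

/-- The characteristic function of a nondegenerate stable law has modulus less than `1` off the
origin. If the modulus is `1` at `θ`, then by stability it is `1` at `2 ^ (-k / α) • θ` for all `k`,
so that the differences of values of `⟪x, θ⟫` lie in `2π 2 ^ (k / α) ℤ` for all `k`, and vanish. -/
lemma IsStableLaw.norm_charFun_lt_one (hα : 0 < α) (hG : IsStableLaw α G)
    (hnd : IsNondegenerate G) {θ : EuclideanSpace ℝ (Fin d)} (hθ : θ ≠ 0) :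
    ‖charFun G θ‖ < 1 := by
  by_contra hlt
  have h1 : ‖charFun G θ‖ = 1 := le_antisymm (norm_charFun_le_one θ) (not_lt.1 hlt)
  set q : ℝ := 2 ^ (1 / α) with hq
  have hq1 : 1 < q := Real.one_lt_rpow one_lt_two (by positivity)
  have hq0 : 0 < q := by linarith
  have hk : ∀ k : ℕ, ‖charFun G ((q ^ k)⁻¹ • θ)‖ = 1 := by
    intro k
    induction k with
    | zero => simpa using h1
    | succ k ih =>
      have := hG.norm_charFun_sq ((q ^ (k + 1))⁻¹ • θ)
      have hqk : q * (q ^ (k + 1))⁻¹ = (q ^ k)⁻¹ := by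
        rw [pow_succ, mul_inv_rev, mul_inv_cancel_left₀ hq0.ne']
      rw [← hq, smul_smul, hqk, ih] at this
      exact (pow_eq_one_iff_of_nonneg (norm_nonneg _) two_ne_zero).1 this
  choose β hβ using fun k => exists_ae_cos_eq_one (hk k)
  have hall : ∀ᵐ x ∂G, ∀ k, Real.cos (⟪x, (q ^ k)⁻¹ • θ⟫ - β k) = 1 := ae_all_iff.2 hβ
  obtain ⟨y, hy⟩ := hall.exists
  refine hnd θ hθ ⟪y, θ⟫ ?_
  filter_upwards [hall] with x hx
  by_contra hne
  have hbd : ∀ k : ℕ, q ^ k ≤ |⟪x, θ⟫ - ⟪y, θ⟫| := by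
    intro k
    obtain ⟨m, hm⟩ := (Real.cos_eq_one_iff _).1 (hx k)
    obtain ⟨l, hl⟩ := (Real.cos_eq_one_iff _).1 (hy k)
    rw [real_inner_smul_right] at hm hl
    have hqk : 0 < q ^ k := by positivity
    have hdiff : (⟪x, θ⟫ : ℝ) - ⟪y, θ⟫ = q ^ k * (((m - l : ℤ) : ℝ) * (2 * Real.pi)) := by
      push_cast
      have : (q ^ k)⁻¹ * (⟪x, θ⟫ - ⟪y, θ⟫) = (m - l) * (2 * Real.pi) := by linarith
      rw [← this, mul_inv_cancel_left₀ hqk.ne']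
    have hml : m - l ≠ 0 := by
      intro h0
      rw [h0] at hdiff
      apply hne
      rw [real_inner_comm x θ]
      simp only [Int.cast_zero, zero_mul, mul_zero] at hdiff
      linarith
    have h1 : (1 : ℝ) ≤ |((m - l : ℤ) : ℝ)| := by
      exact_mod_cast Int.one_le_abs hml
    rw [hdiff, abs_mul, abs_mul, abs_of_pos hqk, abs_of_pos Real.two_pi_pos]
    have := Real.pi_gt_three
    exact le_mul_of_one_le_right hqk.le (by nlinarith)
  obtain ⟨k, hk'⟩ := pow_unbounded_of_one_lt |⟪x, θ⟫ - ⟪y, θ⟫| hq1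
  exact absurd (hbd k) (not_le.2 hk')

/-- A continuous path of complex numbers near `1`, starting at `1`, whose `n`-th powers also stay
near `1`: then `n` times the logarithm is bounded, since its imaginary part cannot cross
`±π / 2`. -/
lemma norm_nat_mul_log_le {z : ℝ → ℂ} {n : ℕ} (hz : ContinuousOn z (Icc 0 1)) (hz0 : z 0 = 1)
    (hz1 : ∀ t ∈ Icc (0 : ℝ) 1, ‖z t - 1‖ ≤ 1 / 2)
    (hzn : ∀ t ∈ Icc (0 : ℝ) 1, ‖z t ^ n - 1‖ ≤ 1 / 2) : ‖n * Complex.log (z 1)‖ ≤ 3 := by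
  have hre : ∀ {w : ℂ}, ‖w - 1‖ ≤ 1 / 2 → 0 < w.re := fun {w} h => by
    have := (abs_le.1 ((Complex.abs_re_le_norm (w - 1)).trans h)).1
    simp only [Complex.sub_re, Complex.one_re] at this
    linarith
  have hne : ∀ t ∈ Icc (0 : ℝ) 1, z t ≠ 0 := fun t ht h => by
    have := hre (hz1 t ht)
    simp [h] at this
  have hexp : ∀ t ∈ Icc (0 : ℝ) 1, Complex.exp (n * Complex.log (z t)) = z t ^ n := fun t ht => by
    rw [Complex.exp_nat_mul, Complex.exp_log (hne t ht)]
  have hcont : ContinuousOn (fun t => |((n : ℂ) * Complex.log (z t)).im|) (Icc 0 1) := by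
    refine (Complex.continuous_im.comp_continuousOn (continuousOn_const.mul ?_)).abs
    exact hz.clog fun t ht => Or.inl (hre (hz1 t ht))
  have him : |((n : ℂ) * Complex.log (z 1)).im| < Real.pi / 2 := by
    by_contra hge
    have h0 : |((n : ℂ) * Complex.log (z 0)).im| = 0 := by simp [hz0]
    obtain ⟨t, ht, htv⟩ := intermediate_value_Icc zero_le_one hcont
      (show Real.pi / 2 ∈ Icc _ _ from ⟨by rw [h0]; positivity, not_lt.1 hge⟩)
    have hpos := hre (hzn t ht)
    beta_reduce at htv
    rw [← hexp t ht, Complex.exp_re, ← Real.cos_abs, htv, Real.cos_pi_div_two] at hpos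
    simp at hpos
  have h1 : (1 : ℝ) ∈ Icc (0 : ℝ) 1 := ⟨zero_le_one, le_rfl⟩
  have hnorm : Real.exp ((n : ℂ) * Complex.log (z 1)).re = ‖z 1 ^ n‖ := by
    rw [← Complex.norm_exp, hexp 1 h1]
  have hup : ‖z 1 ^ n‖ ≤ 3 / 2 := by
    have := norm_add_le (z 1 ^ n - 1) 1
    rw [sub_add_cancel, norm_one] at this
    linarith [hzn 1 h1]
  have hlo : 1 / 2 ≤ ‖z 1 ^ n‖ := by
    have := norm_sub_norm_le 1 (1 - z 1 ^ n)
    rw [sub_sub_cancel, norm_one, norm_sub_rev] at this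
    linarith [hzn 1 h1]
  have hre' : |((n : ℂ) * Complex.log (z 1)).re| ≤ 1 := by
    rw [abs_le]
    constructor
    · by_contra hlt
      have := Real.exp_lt_exp.2 (not_le.1 hlt)
      have h2 := Real.exp_one_gt_d9
      rw [hnorm, Real.exp_neg] at this
      have h3 : (Real.exp 1)⁻¹ < 1 / 2 := by
        rw [one_div]; exact inv_strictAnti₀ two_pos (by linarith)
      linarith
    · have h2 := Real.add_one_le_exp ((n : ℂ) * Complex.log (z 1)).re
      linarith
  refine (Complex.norm_le_abs_re_add_abs_im _).trans ?_
  linarith [Real.pi_lt_d2]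

variable {b : ℕ → ℝ}

/-- The scaled characteristic function is `1 + O(1 / n)` near the origin. -/
lemma exists_norm_charFun_sub_one_le (hb : Tendsto b atTop atTop)
    (hφ : TendstoLocallyUniformly (fun n θ => charFun F ((b n)⁻¹ • θ) ^ n) (charFun G) atTop) :
    ∃ r : ℝ, 0 < r ∧ r ≤ 1 ∧ ∀ᶠ n : ℕ in atTop, ∀ θ, ‖θ‖ ≤ r →
      ‖charFun F ((b n)⁻¹ • θ) - 1‖ ≤ 6 / n := by
  have hnear : ∀ (μ : Measure (EuclideanSpace ℝ (Fin d))) [IsProbabilityMeasure μ],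
      ∃ r > 0, ∀ θ, ‖θ‖ < r → ‖charFun μ θ - 1‖ < 1 / 4 := fun μ _ => by
    have h := Metric.continuousAt_iff.1 ((continuous_charFun (μ := μ)).continuousAt (x := 0))
      (1 / 4) (by norm_num)
    simpa only [dist_eq_norm, sub_zero, charFun_zero, probReal_univ, Complex.ofReal_one] using h
  obtain ⟨r, hr, hrG⟩ := hnear G
  obtain ⟨ρ, hρ, hρF⟩ := hnear F
  refine ⟨min (r / 2) 1, by positivity, min_le_right _ _, ?_⟩
  have hunif := (tendstoLocallyUniformlyOn_iff_tendstoUniformlyOn_of_compact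
    (isCompact_closedBall (0 : EuclideanSpace ℝ (Fin d)) 1)).1 hφ.tendstoLocallyUniformlyOn
  rw [Metric.tendstoUniformlyOn_iff] at hunif
  filter_upwards [hunif (1 / 4) (by norm_num), hb.eventually_gt_atTop (1 / ρ),
    eventually_ge_atTop 3] with n hn hbn hn3 θ hθ
  have hbpos : 0 < b n := lt_trans (by positivity) hbn
  have hθr : ‖θ‖ < r := by linarith [hθ.trans (min_le_left _ _)]
  have hθ1 : ‖θ‖ ≤ 1 := hθ.trans (min_le_right _ _)
  have htθ : ∀ t ∈ Icc (0 : ℝ) 1, ‖t • θ‖ ≤ ‖θ‖ := fun t ht => by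
    rw [norm_smul, Real.norm_of_nonneg ht.1]
    exact mul_le_of_le_one_left (norm_nonneg _) ht.2
  have hlog := norm_nat_mul_log_le (z := fun t => charFun F ((b n)⁻¹ • t • θ)) (n := n)
    (by have := continuous_charFun (μ := F); fun_prop) (by simp)
    (fun t ht => by
      refine (hρF _ ?_).le.trans (by norm_num)
      rw [norm_smul, norm_inv, Real.norm_of_nonneg hbpos.le, inv_mul_lt_iff₀ hbpos]
      have : 1 < b n * ρ := by rwa [div_lt_iff₀ hρ] at hbn
      linarith [htθ t ht])
    (fun t ht => by
      have h1 := hn (t • θ) (by simpa using (htθ t ht).trans hθ1)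
      have h2 := hrG (t • θ) ((htθ t ht).trans_lt hθr)
      rw [dist_eq_norm, norm_sub_rev] at h1
      have := norm_add_le (charFun F ((b n)⁻¹ • t • θ) ^ n - charFun G (t • θ))
        (charFun G (t • θ) - 1)
      rw [sub_add_sub_cancel] at this
      linarith)
  simp only [one_smul] at hlog
  have hn0 : (0 : ℝ) < n := by exact_mod_cast (by omega : 0 < n)
  have hn3' : (3 : ℝ) ≤ n := by exact_mod_cast hn3
  rw [norm_mul, Complex.norm_natCast] at hlog
  set w := Complex.log (charFun F ((b n)⁻¹ • θ)) with hw
  have hwn : ‖w‖ ≤ 3 / n := by rw [le_div_iff₀ hn0]; linarith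
  have hw1 : ‖w‖ ≤ 1 := hwn.trans ((div_le_one hn0).2 hn3')
  have hne : charFun F ((b n)⁻¹ • θ) ≠ 0 := by
    intro h0
    have := hρF ((b n)⁻¹ • θ) (by
      rw [norm_smul, norm_inv, Real.norm_of_nonneg hbpos.le, inv_mul_lt_iff₀ hbpos]
      have : 1 < b n * ρ := by rwa [div_lt_iff₀ hρ] at hbn
      linarith)
    rw [h0] at this
    norm_num at this
  rw [← Complex.exp_log hne, ← hw]
  refine (Complex.norm_exp_sub_one_le hw1).trans ?_
  calc 2 * ‖w‖ ≤ 2 * (3 / n) := by linarith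
    _ = 6 / n := by ring

end Limit

/-- On an annulus the modulus of the scaled characteristic function is at most `1 - ε / n`. -/
lemma exists_le_one_sub_norm_charFun {d : ℕ} {F G : Measure (EuclideanSpace ℝ (Fin d))}
    [IsProbabilityMeasure G] {b : ℕ → ℝ}
    (hφ : TendstoLocallyUniformly (fun n θ => charFun F ((b n)⁻¹ • θ) ^ n) (charFun G) atTop)
    (hG : ∀ θ, θ ≠ 0 → ‖charFun G θ‖ < 1) {R : ℝ} (hR : 0 < R) :
    ∃ ε : ℝ, 0 < ε ∧ ∀ᶠ n : ℕ in atTop, ∀ θ, 1 / R ≤ ‖θ‖ → ‖θ‖ ≤ 1 →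
      ε / n ≤ 1 - ‖charFun F ((b n)⁻¹ • θ)‖ := by
  set K : Set (EuclideanSpace ℝ (Fin d)) := {θ | 1 / R ≤ ‖θ‖} ∩ Metric.closedBall 0 1 with hK
  have hKc : IsCompact K :=
    (isCompact_closedBall 0 1).inter_left (isClosed_le continuous_const continuous_norm)
  have hε : ∃ ε > 0, ∀ θ ∈ K, ‖charFun G θ‖ ≤ 1 - 2 * ε := by
    rcases K.eq_empty_or_nonempty with h | h
    · exact ⟨1, one_pos, by simp [h]⟩
    · obtain ⟨θ₀, hθ₀, hmax⟩ := hKc.exists_isMaxOn h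
        ((continuous_charFun (μ := G)).norm.continuousOn)
      have : θ₀ ≠ 0 := by
        rintro rfl
        have := hθ₀.1
        simp only [mem_ofPred_eq, norm_zero] at this
        have : 0 < 1 / R := by positivity
        linarith
      have := hG θ₀ this
      exact ⟨(1 - ‖charFun G θ₀‖) / 2, by linarith, fun θ hθ => by
        have : ‖charFun G θ‖ ≤ ‖charFun G θ₀‖ := hmax hθ
        linarith⟩
  obtain ⟨ε, hε0, hε⟩ := hε
  refine ⟨ε, hε0, ?_⟩
  have hunif := (tendstoLocallyUniformlyOn_iff_tendstoUniformlyOn_of_compact hKc).1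
    hφ.tendstoLocallyUniformlyOn
  rw [Metric.tendstoUniformlyOn_iff] at hunif
  filter_upwards [hunif ε hε0, eventually_gt_atTop 0] with n hn hn0 θ hθ1 hθ2
  have hθK : θ ∈ K := ⟨hθ1, by simpa using hθ2⟩
  have h1 := hn θ hθK
  have h2 := hε θ hθK
  rw [dist_eq_norm, norm_sub_rev] at h1
  have h3 := norm_sub_norm_le (charFun F ((b n)⁻¹ • θ) ^ n) (charFun G θ)
  rw [norm_pow] at h3
  have h4 := one_add_mul_le_pow (a := ‖charFun F ((b n)⁻¹ • θ)‖ - 1)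
    (by linarith [norm_nonneg (charFun F ((b n)⁻¹ • θ))]) n
  rw [add_sub_cancel] at h4
  have hn0' : (0 : ℝ) < n := by exact_mod_cast hn0
  rw [div_le_iff₀ hn0']
  linarith

/-! ### Truncated moments and the characteristic function -/

section Moments

variable {d : ℕ} {F : Measure (EuclideanSpace ℝ (Fin d))} [IsProbabilityMeasure F]

lemma integrableOn_of_norm_le {H : Type*} [NormedAddCommGroup H]
    {f : EuclideanSpace ℝ (Fin d) → H} (hf : AEStronglyMeasurable f F) {s C : ℝ}
    (h : ∀ x, ‖x‖ ≤ s → ‖f x‖ ≤ C) : IntegrableOn f {x | ‖x‖ ≤ s} F :=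
  IntegrableOn.of_bound (measure_lt_top _ _) hf.restrict C
    ((ae_restrict_iff' (measurableSet_norm_le s)).2 (ae_of_all _ h))

lemma integrableOn_norm_sq (F : Measure (EuclideanSpace ℝ (Fin d))) [IsProbabilityMeasure F]
    (s : ℝ) : IntegrableOn (fun x => ‖x‖ ^ 2) {x | ‖x‖ ≤ s} F :=
  integrableOn_of_norm_le (by fun_prop) (C := s ^ 2) fun x hx => by
    rw [Real.norm_of_nonneg (by positivity)]
    exact pow_le_pow_left₀ (norm_nonneg _) hx 2

lemma integrableOn_id (F : Measure (EuclideanSpace ℝ (Fin d))) [IsProbabilityMeasure F]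
    (s : ℝ) : IntegrableOn (fun x => x) {x | ‖x‖ ≤ s} F :=
  integrableOn_of_norm_le (by fun_prop) fun _ hx => hx

lemma truncSecondMoment_nonneg (F : Measure (EuclideanSpace ℝ (Fin d))) (s : ℝ) :
    0 ≤ truncSecondMoment F s :=
  integral_nonneg fun _ => by positivity

lemma one_sub_re_charFun (F : Measure (EuclideanSpace ℝ (Fin d))) [IsProbabilityMeasure F]
    (η : EuclideanSpace ℝ (Fin d)) :
    1 - (charFun F η).re = ∫ x, (1 - Real.cos ⟪x, η⟫) ∂F := by
  have h := re_exp_mul_charFun F η 0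
  have hint := integrable_cos_inner_sub F η 0
  simp only [Complex.ofReal_zero, neg_zero, zero_mul, Complex.exp_zero, one_mul, sub_zero] at h hint
  rw [integral_sub (integrable_const _) hint, ← h]
  simp

lemma compl_norm_le (s : ℝ) :
    {x : EuclideanSpace ℝ (Fin d) | ‖x‖ ≤ s}ᶜ = {x | s < ‖x‖} := by
  ext x; simp

/-- A function bounded by `a ‖x‖²` on the ball of radius `s`, and by `c` outside, has integral at
most `a V(s) + c P(|X| > s)`. -/
lemma norm_integral_le_truncSecondMoment {f : EuclideanSpace ℝ (Fin d) → ℝ} {s a c : ℝ}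
    (hf : Integrable f F) (h1 : ∀ x, ‖x‖ ≤ s → |f x| ≤ a * ‖x‖ ^ 2)
    (h2 : ∀ x, s < ‖x‖ → |f x| ≤ c) :
    |∫ x, f x ∂F| ≤ a * truncSecondMoment F s + c * F.real {x | s < ‖x‖} := by
  have hB := measurableSet_norm_le (d := d) s
  rw [← integral_add_compl hB hf]
  refine (abs_add_le _ _).trans (add_le_add ?_ ?_)
  · rw [truncSecondMoment, ← integral_const_mul]
    rw [← Real.norm_eq_abs]
    refine norm_integral_le_of_norm_le ((integrableOn_norm_sq F s).const_mul a) ?_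
    exact (ae_restrict_iff' hB).2 (ae_of_all _ h1)
  · rw [compl_norm_le, ← Real.norm_eq_abs]
    exact norm_setIntegral_le_of_norm_le_const (measure_lt_top _ _) fun x hx => h2 x hx

lemma one_sub_re_charFun_le (η : EuclideanSpace ℝ (Fin d)) (s : ℝ) :
    1 - (charFun F η).re ≤ ‖η‖ ^ 2 * truncSecondMoment F s + 2 * F.real {x | s < ‖x‖} := by
  rw [one_sub_re_charFun]
  have hint := (integrable_const (1 : ℝ)).sub (integrable_cos_inner_sub F η 0)
  simp only [sub_zero] at hint
  refine (le_abs_self _).trans (norm_integral_le_truncSecondMoment hint (fun x _ => ?_)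
    fun x _ => ?_)
  · rw [abs_of_nonneg (sub_nonneg.2 (Real.cos_le_one _))]
    have h1 := Real.one_sub_sq_div_two_le_cos (x := ⟪x, η⟫)
    have h2 : (⟪x, η⟫ : ℝ) ^ 2 ≤ (‖x‖ * ‖η‖) ^ 2 := by
      rw [← sq_abs]
      exact pow_le_pow_left₀ (abs_nonneg _) (abs_real_inner_le_norm x η) 2
    nlinarith [sq_nonneg (‖x‖ * ‖η‖)]
  · rw [abs_of_nonneg (sub_nonneg.2 (Real.cos_le_one _))]
    linarith [Real.neg_one_le_cos ⟪x, η⟫]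

/-- The truncated mean, tested against `η`, is controlled by the characteristic function at `η`
because `sin y = y + O(y²)`. -/
lemma abs_inner_truncMean_le {η : EuclideanSpace ℝ (Fin d)} {s : ℝ} (hη : ‖η‖ * s ≤ 1) :
    |⟪∫ x in {x | ‖x‖ ≤ s}, x ∂F, η⟫| ≤ ‖charFun F η - 1‖ +
      (‖η‖ ^ 2 * truncSecondMoment F s + F.real {x | s < ‖x‖}) := by
  have hB := measurableSet_norm_le (d := d) s
  have hsin : Integrable (fun x => Real.sin ⟪x, η⟫) F :=
    Integrable.of_bound (by fun_prop) 1 (ae_of_all _ fun x => Real.abs_sin_le_one _)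
  have hlin : Integrable ({x | ‖x‖ ≤ s}.indicator fun x => (⟪x, η⟫ : ℝ)) F :=
    (integrable_indicator_iff hB).2 ((integrableOn_id F s).inner_const η)
  have him : (charFun F η - 1).im = ∫ x, Real.sin ⟪x, η⟫ ∂F := by
    have hint : Integrable (fun x => Complex.exp ((⟪x, η⟫ : ℝ) * Complex.I)) F :=
      Integrable.of_bound (by fun_prop) 1
        (ae_of_all _ fun x => by rw [Complex.norm_exp_ofReal_mul_I])
    have := integral_im hint
    simp only [RCLike.im_to_complex] at this
    rw [Complex.sub_im, Complex.one_im, sub_zero, charFun_apply, ← this]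
    congr with x
    rw [Complex.exp_ofReal_mul_I_im]
  have hmean : ⟪∫ x in {x | ‖x‖ ≤ s}, x ∂F, η⟫ =
      ∫ x, {x | ‖x‖ ≤ s}.indicator (fun x => (⟪x, η⟫ : ℝ)) x ∂F := by
    rw [integral_indicator hB, real_inner_comm, ← integral_inner (integrableOn_id F s)]
    simp_rw [real_inner_comm η]
  have hdiff := norm_integral_le_truncSecondMoment (s := s) (a := ‖η‖ ^ 2) (c := 1)
    (hlin.sub hsin)
    (fun x hx => by
      simp only [Pi.sub_apply, indicator_of_mem (show x ∈ {x | ‖x‖ ≤ s} from hx)]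
      have hy : |(⟪x, η⟫ : ℝ)| ≤ ‖x‖ * ‖η‖ := abs_real_inner_le_norm x η
      have hy1 : |(⟪x, η⟫ : ℝ)| ≤ 1 := hy.trans (by nlinarith [norm_nonneg η])
      have h := Complex.norm_exp_sub_one_sub_id_le (x := (⟪x, η⟫ : ℝ) * Complex.I)
        (by simpa using hy1)
      have h' := (Complex.abs_im_le_norm _).trans h
      rw [Complex.sub_im, Complex.sub_im, Complex.exp_ofReal_mul_I_im] at h'
      simp only [Complex.one_im, sub_zero, Complex.mul_im, Complex.ofReal_re, Complex.I_im,
        mul_one, Complex.ofReal_im, Complex.I_re, mul_zero, add_zero, norm_mul, Complex.norm_real,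
        Complex.norm_I, Real.norm_eq_abs] at h'
      rw [abs_sub_comm]
      refine h'.trans ?_
      rw [← mul_pow, mul_comm ‖η‖]
      exact pow_le_pow_left₀ (abs_nonneg _) hy 2)
    (fun x hx => by
      simp only [Pi.sub_apply, indicator_of_notMem (show x ∉ {x | ‖x‖ ≤ s} from not_le.2 hx),
        zero_sub, abs_neg]
      exact Real.abs_sin_le_one _)
  have hsub : ∫ x, ({x | ‖x‖ ≤ s}.indicator (fun x => (⟪x, η⟫ : ℝ)) - fun x => Real.sin ⟪x, η⟫) x ∂F
      = ⟪∫ x in {x | ‖x‖ ≤ s}, x ∂F, η⟫ - (charFun F η - 1).im := by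
    rw [hmean, him, ← integral_sub hlin hsin]
    rfl
  rw [hsub, one_mul] at hdiff
  have h1 := abs_sub_abs_le_abs_sub ⟪∫ x in {x | ‖x‖ ≤ s}, x ∂F, η⟫ (charFun F η - 1).im
  linarith [Complex.abs_im_le_norm (charFun F η - 1)]

/-- The truncated second moment is controlled by the characteristic function along the axes. -/
lemma truncSecondMoment_le {r s ε : ℝ} (hr : 0 < r) (hr1 : r ≤ 1) (hs : 0 < s)
    (h : ∀ θ, ‖θ‖ ≤ r → ‖charFun F (s⁻¹ • θ) - 1‖ ≤ ε) :
    truncSecondMoment F s ≤ 8 * d * ε / r ^ 2 * s ^ 2 := by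
  have hB := measurableSet_norm_le (d := d) s
  -- `1 - cos y ≥ y ^ 2 / 8` for `|y| ≤ 1`, summed over the coordinate directions.
  set e : Fin d → EuclideanSpace ℝ (Fin d) := fun i => s⁻¹ • EuclideanSpace.single i r with he
  have hin : ∀ x i, ⟪x, e i⟫ = s⁻¹ * (r * x i) := fun x i => by
    rw [he, real_inner_smul_right, EuclideanSpace.inner_single_right]
    simp
  have hint : ∀ i, Integrable (fun x => 1 - Real.cos ⟪x, e i⟫) F := fun i => by
    have := integrable_cos_inner_sub F (e i) 0
    simp only [sub_zero] at this
    exact (integrable_const (1 : ℝ)).sub this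
  have h1 : ∀ i, ∫ x, (1 - Real.cos ⟪x, e i⟫) ∂F ≤ ε := fun i => by
    rw [← one_sub_re_charFun]
    have h2 := h (EuclideanSpace.single i r) (by simp [abs_of_pos hr])
    rw [norm_sub_rev] at h2
    have h3 := (Complex.re_le_norm _).trans h2
    simpa using h3
  have hpt : ∀ x, ‖x‖ ≤ s → r ^ 2 / (8 * s ^ 2) * ‖x‖ ^ 2 ≤ ∑ i, (1 - Real.cos ⟪x, e i⟫) := by
    intro x hx
    rw [EuclideanSpace.real_norm_sq_eq, Finset.mul_sum]
    refine Finset.sum_le_sum fun i _ => ?_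
    have hxi : |x i| ≤ s := (PiLp.norm_apply_le x i).trans hx
    have hy : |(⟪x, e i⟫ : ℝ)| ≤ 1 := by
      rw [hin, abs_mul, abs_mul, abs_of_pos hr, abs_of_pos (inv_pos.2 hs), inv_mul_le_iff₀ hs]
      nlinarith [abs_nonneg (x i)]
    have hcos := Real.cos_le_one_sub_mul_cos_sq (hy.trans (by linarith [Real.pi_gt_three]))
    have hpi : 1 / 8 ≤ 2 / Real.pi ^ 2 := by
      rw [div_le_div_iff₀ (by norm_num) (by positivity)]
      nlinarith [Real.pi_pos, Real.pi_le_four]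
    have heq : r ^ 2 / (8 * s ^ 2) * x i ^ 2 = 1 / 8 * (⟪x, e i⟫ : ℝ) ^ 2 := by
      rw [hin]; field_simp
    rw [heq]
    nlinarith [sq_nonneg (⟪x, e i⟫ : ℝ)]
  have hkey : r ^ 2 / (8 * s ^ 2) * truncSecondMoment F s ≤ d * ε := by
    rw [truncSecondMoment, ← integral_const_mul]
    calc ∫ x in {x | ‖x‖ ≤ s}, r ^ 2 / (8 * s ^ 2) * ‖x‖ ^ 2 ∂F
        ≤ ∫ x in {x | ‖x‖ ≤ s}, ∑ i, (1 - Real.cos ⟪x, e i⟫) ∂F :=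
          setIntegral_mono_on ((integrableOn_norm_sq F s).const_mul _)
            (integrable_finsetSum _ fun i _ => hint i).integrableOn hB hpt
      _ ≤ ∫ x, ∑ i, (1 - Real.cos ⟪x, e i⟫) ∂F :=
          setIntegral_le_integral (integrable_finsetSum _ fun i _ => hint i)
            (ae_of_all _ fun x => Finset.sum_nonneg fun i _ => sub_nonneg.2 (Real.cos_le_one _))
      _ = ∑ i, ∫ x, (1 - Real.cos ⟪x, e i⟫) ∂F := integral_finsetSum _ fun i _ => hint i
      _ ≤ ∑ _i : Fin d, ε := Finset.sum_le_sum fun i _ => h1 i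
      _ = d * ε := by simp
  rw [div_mul_eq_mul_div, div_le_iff₀ (by positivity)] at hkey
  rw [div_mul_eq_mul_div, le_div_iff₀ (by positivity)]
  linarith

end Moments

/-! ### Consequences of attraction at all scales -/

section Attraction

variable {d : ℕ} {F G : Measure (EuclideanSpace ℝ (Fin d))} [IsProbabilityMeasure F]
  [IsProbabilityMeasure G] {A : ℝ → ℝ} {b : ℕ → ℝ}

lemma InDomainOfAttractionWithoutCentering.exists_charFun {α : ℝ} (hα : 0 < α)
    (hF : InDomainOfAttractionWithoutCentering α F) :
    ∃ b : ℕ → ℝ, Tendsto b atTop atTop ∧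
      ∃ (G : Measure (EuclideanSpace ℝ (Fin d))) (_ : IsProbabilityMeasure G),
        TendstoLocallyUniformly (fun n θ => charFun F ((b n)⁻¹ • θ) ^ n) (charFun G) atTop ∧
        ∀ θ, θ ≠ 0 → ‖charFun G θ‖ < 1 := by
  obtain ⟨b, hb, G, hG, hst, hnd, hconv⟩ := hF
  refine ⟨b, hb, G, hG, ?_, fun θ hθ => hst.norm_charFun_lt_one hα hnd hθ⟩
  have := tendstoLocallyUniformly_charFun hconv
  simpa only [charFun_map_partialSum, Measure.map_id] using this

lemma eventually_le_truncSecondMoment (hb : Tendsto b atTop atTop)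
    (hφ : TendstoLocallyUniformly (fun n θ => charFun F ((b n)⁻¹ • θ) ^ n) (charFun G) atTop) :
    ∃ C : ℝ, 0 < C ∧ ∀ᶠ n : ℕ in atTop, truncSecondMoment F (b n) ≤ C / n * b n ^ 2 := by
  obtain ⟨r, hr, hr1, h⟩ := exists_norm_charFun_sub_one_le hb hφ
  refine ⟨48 * d / r ^ 2 + 1, by positivity, ?_⟩
  filter_upwards [h, hb.eventually_gt_atTop 0, eventually_gt_atTop 0] with n hn hbn hn0
  have hn0' : (0 : ℝ) < n := by exact_mod_cast hn0
  refine (truncSecondMoment_le hr hr1 hbn hn).trans ?_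
  refine mul_le_mul_of_nonneg_right ?_ (by positivity)
  have : 8 * d * (6 / n) / r ^ 2 = (48 * d / r ^ 2) / (n : ℝ) := by field_simp; ring
  rw [this]
  gcongr
  linarith

/-- `A (b n)` is at least of order `n`. -/
lemma IsScalingFunction.eventually_nat_le (hA : IsScalingFunction F A)
    (hb : Tendsto b atTop atTop)
    (hφ : TendstoLocallyUniformly (fun n θ => charFun F ((b n)⁻¹ • θ) ^ n) (charFun G) atTop) :
    ∃ C : ℝ, 0 < C ∧ ∀ᶠ n : ℕ in atTop, n ≤ C * A (b n) := by
  obtain ⟨C, hC, h⟩ := eventually_le_truncSecondMoment hb hφ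
  obtain ⟨s₁, hs₁, hV⟩ := hA.exists_mul_truncSecondMoment
  refine ⟨2 * C, by positivity, ?_⟩
  filter_upwards [h, hb.eventually_ge_atTop s₁, eventually_gt_atTop 0] with n hn hbn hn0
  have hn0' : (0 : ℝ) < n := by exact_mod_cast hn0
  have hbpos : 0 < b n := hs₁.trans_le hbn
  have h1 := (hV _ hbn).1
  have h2 := mul_le_mul_of_nonneg_left hn (hA.pos hbpos).le
  have h3 : b n ^ 2 * n ≤ b n ^ 2 * (2 * C * A (b n)) := by
    have h4 := h1.trans h2
    rw [div_mul_eq_mul_div, mul_div_assoc', le_div_iff₀ hn0'] at h4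
    linarith
  exact le_of_mul_le_mul_left h3 (by positivity)

/-- The characteristic function is within `O(1 / A(s))` of the unit circle for `‖η‖ ≤ 1 / s`. -/
lemma IsScalingFunction.exists_one_sub_norm_charFun_le (hA : IsScalingFunction F A) :
    ∃ C s₁ : ℝ, 0 < C ∧ 0 < s₁ ∧ ∀ s, s₁ ≤ s → ∀ η : EuclideanSpace ℝ (Fin d), ‖η‖ * s ≤ 1 →
      1 - ‖charFun F η‖ ≤ C / A s := by
  obtain ⟨s₁, hs₁, hV⟩ := hA.exists_mul_truncSecondMoment
  obtain ⟨C, s₂, hC, hs₂, hT⟩ := hA.exists_tail_le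
  refine ⟨2 + 2 * C, max s₁ s₂, by positivity, by positivity, fun s hs η hη => ?_⟩
  have hs0 : 0 < s := hs₁.trans_le ((le_max_left _ _).trans hs)
  have h1 := one_sub_re_charFun_le (F := F) η s
  have h2 := hT s ((le_max_right _ _).trans hs)
  have h3 := (hV s ((le_max_left _ _).trans hs)).2
  have hApos := hA.pos hs0
  have h4 : ‖η‖ ^ 2 * truncSecondMoment F s ≤ 2 / A s := by
    rw [le_div_iff₀ hApos]
    have : (‖η‖ * s) ^ 2 ≤ 1 := pow_le_one₀ (by positivity) hη
    nlinarith [mul_le_mul_of_nonneg_left h3 (sq_nonneg ‖η‖)]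
  have h5 := Complex.re_le_norm (charFun F η)
  have h6 : (2 + 2 * C) / A s = 2 / A s + 2 * (C / A s) := by ring
  linarith

/-- `A (b n)` is at most of order `n`. -/
lemma IsScalingFunction.eventually_le_nat (hd : 1 ≤ d) (hA : IsScalingFunction F A)
    (hb : Tendsto b atTop atTop)
    (hφ : TendstoLocallyUniformly (fun n θ => charFun F ((b n)⁻¹ • θ) ^ n) (charFun G) atTop)
    (hG : ∀ θ, θ ≠ 0 → ‖charFun G θ‖ < 1) :
    ∃ C : ℝ, 0 < C ∧ ∀ᶠ n : ℕ in atTop, A (b n) ≤ C * n := by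
  obtain ⟨C, s₁, hC, hs₁, hup⟩ := hA.exists_one_sub_norm_charFun_le
  obtain ⟨ε, hε, hlow⟩ := exists_le_one_sub_norm_charFun hφ hG one_pos
  refine ⟨C / ε, by positivity, ?_⟩
  filter_upwards [hlow, hb.eventually_ge_atTop s₁, eventually_gt_atTop 0] with n hn hbn hn0
  have hn0' : (0 : ℝ) < n := by exact_mod_cast hn0
  have hbpos : 0 < b n := hs₁.trans_le hbn
  set θ : EuclideanSpace ℝ (Fin d) := EuclideanSpace.single ⟨0, hd⟩ 1 with hθdef
  have hθ : ‖θ‖ = 1 := by simp [hθdef]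
  have h1 := hn θ (by simp [hθ]) hθ.le
  have h2 := hup (b n) hbn ((b n)⁻¹ • θ) (by
    rw [norm_smul, hθ, norm_inv, Real.norm_of_nonneg hbpos.le, mul_one,
      inv_mul_cancel₀ hbpos.ne'])
  have h3 := h1.trans h2
  rw [div_le_div_iff₀ hn0' (hA.pos hbpos)] at h3
  rw [div_mul_eq_mul_div, le_div_iff₀ hε]
  linarith

/-- The truncated means at the levels `b n` are `O(b n / n)`. This is where the absence of
centering enters. -/
lemma IsScalingFunction.eventually_truncMean_le (hA : IsScalingFunction F A)
    (hb : Tendsto b atTop atTop)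
    (hφ : TendstoLocallyUniformly (fun n θ => charFun F ((b n)⁻¹ • θ) ^ n) (charFun G) atTop) :
    ∃ C : ℝ, 0 < C ∧ ∀ᶠ n : ℕ in atTop,
      ‖∫ x in {x | ‖x‖ ≤ b n}, x ∂F‖ ≤ C / n * b n := by
  obtain ⟨r, hr, hr1, hL⟩ := exists_norm_charFun_sub_one_le hb hφ
  obtain ⟨C₁, hC₁, hV⟩ := eventually_le_truncSecondMoment hb hφ
  obtain ⟨C₂, hC₂, hn⟩ := hA.eventually_nat_le hb hφ
  obtain ⟨C₃, s₂, hC₃, hs₂, hT⟩ := hA.exists_tail_le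
  refine ⟨(6 + (C₁ + C₂ * C₃)) / r, by positivity, ?_⟩
  filter_upwards [hL, hV, hn, hb.eventually_ge_atTop s₂, eventually_gt_atTop 0] with
    n hL hV hn hbn hn0
  have hn0' : (0 : ℝ) < n := by exact_mod_cast hn0
  have hbpos : 0 < b n := hs₂.trans_le hbn
  set m := ∫ x in {x | ‖x‖ ≤ b n}, x ∂F with hm
  rcases eq_or_ne m 0 with h0 | h0
  · rw [h0, norm_zero]; positivity
  have hm0 : 0 < ‖m‖ := norm_pos_iff.2 h0
  set θ : EuclideanSpace ℝ (Fin d) := (r / ‖m‖) • m with hθ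
  have hθn : ‖θ‖ = r := by
    rw [hθ, norm_smul, Real.norm_of_nonneg (by positivity), div_mul_cancel₀ _ hm0.ne']
  have hηn : ‖(b n)⁻¹ • θ‖ = (b n)⁻¹ * r := by
    rw [norm_smul, hθn, Real.norm_of_nonneg (inv_nonneg.2 hbpos.le)]
  have h1 := abs_inner_truncMean_le (F := F) (η := (b n)⁻¹ • θ) (s := b n) (by
    rw [hηn, mul_right_comm, inv_mul_cancel₀ hbpos.ne', one_mul]; exact hr1)
  rw [← hm, hηn, real_inner_smul_right, hθ, real_inner_smul_right, real_inner_self_eq_norm_sq] at h1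
  have hval : (b n)⁻¹ * (r / ‖m‖ * ‖m‖ ^ 2) = r * ‖m‖ / b n := by field_simp
  rw [hval] at h1
  have h2 : ((b n)⁻¹ * r) ^ 2 * truncSecondMoment F (b n) ≤ C₁ / n := by
    have hsq : ((b n)⁻¹ * r) ^ 2 ≤ (b n ^ 2)⁻¹ := by
      rw [mul_pow, inv_pow]
      exact mul_le_of_le_one_right (by positivity) (pow_le_one₀ hr.le hr1)
    calc _ ≤ (b n ^ 2)⁻¹ * (C₁ / n * b n ^ 2) :=
          mul_le_mul hsq hV (truncSecondMoment_nonneg F _) (by positivity)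
      _ = C₁ / n := by field_simp
  have h3 : F.real {x | b n < ‖x‖} ≤ C₂ * C₃ / n := by
    refine (hT _ hbn).trans ?_
    rw [div_le_div_iff₀ (hA.pos hbpos) hn0']
    nlinarith
  have h4 := (le_abs_self _).trans h1
  have h5 := hL θ hθn.le
  rw [hθ] at h5
  have h6 : r * ‖m‖ / b n ≤ (6 + (C₁ + C₂ * C₃)) / n := by
    have : (6 + (C₁ + C₂ * C₃)) / (n : ℝ) = 6 / n + (C₁ / n + C₂ * C₃ / n) := by ring
    linarith
  rw [div_le_iff₀ hbpos] at h6
  have h7 : (6 + (C₁ + C₂ * C₃)) / r / n * b n = ((6 + (C₁ + C₂ * C₃)) / n * b n) / r := by ring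
  rw [h7, le_div_iff₀ hr]
  linarith

/-- The norming constants do not leave gaps: every large `t` lies in `[b n, R b n]` for some
large `n`. -/
lemma IsScalingFunction.exists_between (hd : 1 ≤ d) (hA : IsScalingFunction F A)
    (hb : Tendsto b atTop atTop)
    (hφ : TendstoLocallyUniformly (fun n θ => charFun F ((b n)⁻¹ • θ) ^ n) (charFun G) atTop)
    (hG : ∀ θ, θ ≠ 0 → ‖charFun G θ‖ < 1) :
    ∃ R : ℝ, 1 ≤ R ∧ ∀ N : ℕ, ∃ t₀ : ℝ, ∀ t, t₀ ≤ t → ∃ n, N ≤ n ∧ b n ≤ t ∧ t ≤ R * b n := by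
  obtain ⟨C₁, hC₁, h₁⟩ := hA.eventually_nat_le hb hφ
  obtain ⟨C₂, hC₂, h₂⟩ := hA.eventually_le_nat hd hb hφ hG
  obtain ⟨κ, hκ, hgrow⟩ := hA.exists_rpow_mul_le
  -- Since `A (b n)` has exact order `n`, the growth of `A` bounds `b (n + 1) / b n`.
  set R : ℝ := max 1 ((2 * C₂ * C₁) ^ κ⁻¹) with hR
  have hstep : ∀ᶠ n in atTop, b (n + 1) ≤ R * b n := by
    filter_upwards [h₁, (tendsto_add_atTop_nat 1).eventually h₂, hb.eventually_gt_atTop 0,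
      eventually_ge_atTop 1] with n h₁ h₂ hbn hn1
    have hn1' : (1 : ℝ) ≤ n := by exact_mod_cast hn1
    rcases le_total (b (n + 1)) (b n) with hle | hle
    · exact hle.trans (le_mul_of_one_le_left hbn.le (le_max_left _ _))
    have hA1 : A (b (n + 1)) ≤ 2 * C₂ * C₁ * A (b n) := by
      refine h₂.trans ?_
      push_cast
      nlinarith
    have hl : 1 ≤ b (n + 1) / b n := (one_le_div hbn).2 hle
    have hg := hgrow (b n) (b (n + 1) / b n) hbn hl
    rw [div_mul_cancel₀ _ hbn.ne'] at hg
    have hpow := le_of_mul_le_mul_right (hg.trans hA1) (hA.pos hbn)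
    have hroot := (Real.le_rpow_inv_iff_of_pos (by positivity) (by positivity) hκ).2 hpow
    rw [div_le_iff₀ hbn] at hroot
    exact hroot.trans (mul_le_mul_of_nonneg_right (le_max_right _ _) hbn.le)
  refine ⟨R, le_max_left _ _, fun N => ?_⟩
  obtain ⟨N₁, hN₁⟩ := hstep.exists_forall_of_atTop
  set M := max N N₁ with hM
  refine ⟨b M, fun t ht => ?_⟩
  have hex : ∃ m, t < b (M + m) := by
    obtain ⟨k, hk1, hk2⟩ := ((eventually_ge_atTop M).and (hb.eventually_gt_atTop t)).exists
    exact ⟨k - M, by rwa [Nat.add_sub_cancel' hk1]⟩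
  classical
  have hfind := Nat.find_spec hex
  have hne : Nat.find hex ≠ 0 := fun h0 => by
    rw [h0, add_zero] at hfind
    linarith
  obtain ⟨m, hm⟩ := Nat.exists_eq_succ_of_ne_zero hne
  have hmin := Nat.find_min hex (m := m) (by omega)
  rw [hm] at hfind
  refine ⟨M + m, (le_max_left N N₁).trans (Nat.le_add_right _ _), not_lt.1 hmin, ?_⟩
  exact hfind.le.trans (hN₁ (M + m) ((le_max_right N N₁).trans (Nat.le_add_right _ _)))

/-- The two facts about `F` that the local bound rests on: the characteristic function leaves the
unit circle at the rate `1 / A` near the origin, and the truncated mean is `O(s / A(s))`. -/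
lemma InDomainOfAttractionWithoutCentering.exists_bounds {α : ℝ} (hd : 1 ≤ d) (hα : 0 < α)
    (hF : InDomainOfAttractionWithoutCentering α F) (hA : IsScalingFunction F A) :
    ∃ c C t₀ : ℝ, 0 < c ∧ 0 < C ∧ 0 < t₀ ∧ ∀ t, t₀ ≤ t →
      (∀ θ : EuclideanSpace ℝ (Fin d), ‖θ‖ = 1 / t → c / A t ≤ 1 - ‖charFun F θ‖) ∧
      ‖∫ x in {x | ‖x‖ ≤ t}, x ∂F‖ ≤ C / A t * t := by
  obtain ⟨b, hb, G, _, hφ, hG⟩ := hF.exists_charFun hα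
  obtain ⟨R, hR1, hbetween⟩ := hA.exists_between hd hb hφ hG
  obtain ⟨C₁, hC₁, h₁⟩ := hA.eventually_nat_le hb hφ
  obtain ⟨C₂, hC₂, h₂⟩ := hA.eventually_le_nat hd hb hφ hG
  obtain ⟨C₃, hC₃, h₃⟩ := hA.eventually_truncMean_le hb hφ
  obtain ⟨C₄, s₄, hC₄, hs₄, h₄⟩ := hA.exists_tail_le
  have hR0 : 0 < R := by linarith
  obtain ⟨ε, hε, h₅⟩ := exists_le_one_sub_norm_charFun hφ hG hR0
  obtain ⟨κ, hκ, hgrow⟩ := hA.exists_le_rpow_mul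
  obtain ⟨N, hN⟩ := (h₁.and (h₂.and (h₃.and (h₅.and ((hb.eventually_ge_atTop s₄).and
    (eventually_gt_atTop 0)))))).exists_forall_of_atTop
  obtain ⟨t₀, ht₀⟩ := hbetween N
  refine ⟨ε / C₁, (C₃ * C₂ + C₄) * R ^ κ, max t₀ 1, by positivity, by positivity, by positivity,
    fun t ht => ?_⟩
  obtain ⟨n, hn, hbt, htb⟩ := ht₀ t ((le_max_left _ _).trans ht)
  obtain ⟨h₁, h₂, h₃, h₅, hbs, hn0⟩ := hN n hn
  have hn0' : (0 : ℝ) < n := by exact_mod_cast hn0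
  have hbpos : 0 < b n := hs₄.trans_le hbs
  have htpos : 0 < t := hbpos.trans_le hbt
  have hAt := hA.pos htpos
  have hAb := hA.pos hbpos
  have hAbt := hA.mono hbpos.le hbt
  constructor
  · intro θ hθ
    have h := h₅ (b n • θ) (by
      rw [norm_smul, Real.norm_of_nonneg hbpos.le, hθ, mul_one_div, div_le_div_iff₀ hR0 htpos]
      linarith) (by
      rw [norm_smul, Real.norm_of_nonneg hbpos.le, hθ, mul_one_div]
      exact (div_le_one htpos).2 hbt)
    rw [smul_smul, inv_mul_cancel₀ hbpos.ne', one_smul] at h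
    refine le_trans ?_ h
    rw [div_div, div_le_div_iff₀ (by positivity) hn0']
    refine mul_le_mul_of_nonneg_left (h₁.trans ?_) hε.le
    exact mul_le_mul_of_nonneg_left hAbt hC₁.le
  · have hAtb : A t ≤ R ^ κ * A (b n) := by
      have h := hgrow (b n) (t / b n) hbpos ((one_le_div hbpos).2 hbt)
      rw [div_mul_cancel₀ _ hbpos.ne'] at h
      refine h.trans (mul_le_mul_of_nonneg_right ?_ hAb.le)
      exact Real.rpow_le_rpow (by positivity) ((div_le_iff₀ hbpos).2 htb) hκ.le
    have hinv : 1 / A (b n) ≤ R ^ κ / A t := by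
      rw [div_le_div_iff₀ hAb hAt]; linarith
    have hsplit : {x : EuclideanSpace ℝ (Fin d) | ‖x‖ ≤ t} =
        {x | ‖x‖ ≤ b n} ∪ ({x | ‖x‖ ≤ t} \ {x | ‖x‖ ≤ b n}) :=
      (union_sdiff_cancel fun x hx => le_trans (show ‖x‖ ≤ b n from hx) hbt).symm
    have hmeas : MeasurableSet ({x : EuclideanSpace ℝ (Fin d) | ‖x‖ ≤ t} \ {x | ‖x‖ ≤ b n}) :=
      (measurableSet_norm_le _).diff (measurableSet_norm_le _)
    have hann : ‖∫ x in {x | ‖x‖ ≤ t} \ {x | ‖x‖ ≤ b n}, x ∂F‖ ≤ t * (C₄ / A (b n)) := by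
      refine (norm_setIntegral_le_of_norm_le_const (measure_lt_top _ _)
        (fun x hx => hx.1)).trans (mul_le_mul_of_nonneg_left ?_ htpos.le)
      refine (measureReal_mono fun x hx => ?_).trans (h₄ _ hbs)
      exact not_le.1 (show ¬ ‖x‖ ≤ b n from hx.2)
    have hmean : ‖∫ x in {x | ‖x‖ ≤ b n}, x ∂F‖ ≤ t * (C₃ * C₂ / A (b n)) := by
      refine h₃.trans ?_
      have : C₃ / n ≤ C₃ * C₂ / A (b n) := by
        rw [div_le_div_iff₀ hn0' hAb]
        nlinarith
      calc C₃ / n * b n ≤ C₃ * C₂ / A (b n) * t := mul_le_mul this hbt hbpos.le (by positivity)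
        _ = _ := mul_comm _ _
    rw [hsplit, setIntegral_union disjoint_sdiff_right hmeas (integrableOn_id F _)
      ((integrableOn_id F t).mono_set sdiff_subset)]
    refine (norm_add_le _ _).trans ((add_le_add hmean hann).trans ?_)
    calc t * (C₃ * C₂ / A (b n)) + t * (C₄ / A (b n))
        = t * ((C₃ * C₂ + C₄) * (1 / A (b n))) := by ring
      _ ≤ t * ((C₃ * C₂ + C₄) * (R ^ κ / A t)) := by gcongr
      _ = _ := by ring

end Attraction

/-! ### Smoothing -/

section Smoothing

variable {E : Type*} [NormedAddCommGroup E] [InnerProductSpace ℝ E] [FiniteDimensional ℝ E]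
  [MeasurableSpace E] [BorelSpace E]

lemma half_volume_le_norm_integral_exp {δ : ℝ} (hδ : 0 < δ) {y : E} (hy : ‖y‖ ≤ 1 / δ) :
    volume.real (Metric.closedBall (0 : E) δ) / 2 ≤
      ‖∫ θ in Metric.closedBall (0 : E) δ, Complex.exp ((⟪y, θ⟫ : ℝ) * Complex.I)‖ := by
  have hfin : volume (Metric.closedBall (0 : E) δ) < ⊤ := measure_closedBall_lt_top
  have : IsFiniteMeasure (volume.restrict (Metric.closedBall (0 : E) δ)) := ⟨by simpa using hfin⟩
  have hint : Integrable (fun θ : E => Complex.exp ((⟪y, θ⟫ : ℝ) * Complex.I))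
      (volume.restrict (Metric.closedBall (0 : E) δ)) :=
    Integrable.of_bound (by fun_prop) 1
      (ae_of_all _ fun x => by rw [Complex.norm_exp_ofReal_mul_I])
  refine le_trans ?_ (Complex.re_le_norm _)
  have hre := integral_re hint
  simp only [RCLike.re_to_complex] at hre
  rw [← hre]
  have hconst : volume.real (Metric.closedBall (0 : E) δ) / 2 =
      ∫ _θ in Metric.closedBall (0 : E) δ, (1 / 2 : ℝ) := by
    rw [setIntegral_const, smul_eq_mul]; ring
  rw [hconst]
  refine setIntegral_mono_on (integrable_const _) hint.re measurableSet_closedBall fun θ hθ => ?_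
  rw [Complex.exp_ofReal_mul_I_re]
  have h1 : |(⟪y, θ⟫ : ℝ)| ≤ 1 := by
    refine (abs_real_inner_le_norm y θ).trans ?_
    have h2 : ‖θ‖ ≤ δ := by simpa using hθ
    calc ‖y‖ * ‖θ‖ ≤ 1 / δ * δ := mul_le_mul hy h2 (norm_nonneg _) (by positivity)
      _ = 1 := by field_simp
  have h3 := Real.one_sub_sq_div_two_le_cos (x := ⟪y, θ⟫)
  have h4 : (⟪y, θ⟫ : ℝ) ^ 2 ≤ 1 := (sq_le_one_iff_abs_le_one _).2 h1
  linarith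

/-- Translating a ball of radius `δ` by a vector of length at most `δ` keeps it within the ball of
radius `2 δ`. -/
lemma setIntegral_sub_le {g : E → ℝ} (hg : Continuous g) (hg0 : ∀ θ, 0 ≤ g θ) {δ : ℝ}
    {θ' : E} (hθ' : θ' ∈ Metric.closedBall (0 : E) δ) :
    ∫ θ in Metric.closedBall (0 : E) δ, g (θ - θ') ≤
      ∫ θ in Metric.closedBall (0 : E) (2 * δ), g θ := by
  rw [← integral_indicator measurableSet_closedBall, ← integral_indicator measurableSet_closedBall,
    ← integral_sub_right_eq_self ((Metric.closedBall (0 : E) (2 * δ)).indicator g) θ']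
  have hcont : ∀ r : ℝ, IntegrableOn g (Metric.closedBall 0 r) := fun r =>
    hg.continuousOn.integrableOn_compact (isCompact_closedBall _ _)
  have hshift : Continuous fun θ => g (θ - θ') := by fun_prop
  refine integral_mono ((integrable_indicator_iff measurableSet_closedBall).2
      (hshift.continuousOn.integrableOn_compact (isCompact_closedBall _ _)))
    (((integrable_indicator_iff measurableSet_closedBall).2 (hcont _)).comp_sub_right θ')
    fun θ => ?_
  by_cases hθ : θ ∈ Metric.closedBall (0 : E) δ
  · have : θ - θ' ∈ Metric.closedBall (0 : E) (2 * δ) := by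
      simp only [mem_closedBall_zero_iff] at *
      exact (norm_sub_le _ _).trans (by linarith)
    simp only [indicator_of_mem hθ, indicator_of_mem this, le_refl]
  · simp only [indicator_of_notMem hθ]
    exact indicator_nonneg (fun x _ => hg0 x) _

/-- An Esseen type inequality. The squared modulus of the Fourier transform of the uniform measure
on a ball serves as the smoothing kernel; its Fourier transform has compact support. -/
lemma measureReal_closedBall_le (μ : Measure E) [IsFiniteMeasure μ] (x : E) {δ : ℝ} (hδ : 0 < δ) :
    μ.real (Metric.closedBall x (1 / δ)) ≤
      4 / volume.real (Metric.closedBall (0 : E) δ) *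
        ∫ θ in Metric.closedBall (0 : E) (2 * δ), ‖charFun μ θ‖ := by
  set B := Metric.closedBall (0 : E) δ with hB
  set v := volume.real B with hv
  have hvpos : 0 < v :=
    ENNReal.toReal_pos (Metric.measure_closedBall_pos volume 0 hδ).ne' measure_closedBall_lt_top.ne
  have : IsFiniteMeasure (volume.restrict B) := ⟨by simpa using measure_closedBall_lt_top⟩
  set lam := volume.restrict B with hlam
  set J := ∫ θ in Metric.closedBall (0 : E) (2 * δ), ‖charFun μ θ‖ with hJ
  let D : E → ℂ := fun y => ∫ θ, Complex.exp ((⟪y - x, θ⟫ : ℝ) * Complex.I) ∂lam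
  have hexp : ∀ (r : ℝ), ‖Complex.exp ((r : ℂ) * Complex.I)‖ ≤ 1 := fun r => by
    rw [Complex.norm_exp_ofReal_mul_I]
  have hsq : ∀ y, ((‖D y‖ ^ 2 : ℝ) : ℂ) = ∫ p : E × E,
      Complex.exp ((⟪y - x, p.1 - p.2⟫ : ℝ) * Complex.I) ∂(lam.prod lam) := by
    intro y
    have hconj : (starRingEnd ℂ) (D y) =
        ∫ θ, Complex.exp (((-⟪y - x, θ⟫ : ℝ) : ℂ) * Complex.I) ∂lam := by
      rw [← integral_conj]
      congr with θ
      rw [← Complex.exp_conj]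
      simp
    rw [← Complex.normSq_eq_norm_sq, ← Complex.mul_conj, hconj, ← integral_prod_mul]
    congr with p
    rw [← Complex.exp_add, ← add_mul, inner_sub_right, ← Complex.ofReal_add,
      sub_eq_add_neg (⟪y - x, p.1⟫ : ℝ)]
  have hmeasD : Measurable fun y => ‖D y‖ ^ 2 := by
    have : StronglyMeasurable D :=
      StronglyMeasurable.integral_prod_right
        (f := fun y θ => Complex.exp ((⟪y - x, θ⟫ : ℝ) * Complex.I))
        (by apply Continuous.stronglyMeasurable; fun_prop)
    exact this.measurable.norm.pow_const 2
  have hintD : Integrable (fun y => ‖D y‖ ^ 2) μ := by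
    refine Integrable.of_bound hmeasD.aestronglyMeasurable (v ^ 2) (ae_of_all _ fun y => ?_)
    rw [Real.norm_of_nonneg (by positivity)]
    refine pow_le_pow_left₀ (norm_nonneg _) ?_ 2
    refine (norm_integral_le_of_norm_le_const (ae_of_all _ fun θ => hexp _)).trans ?_
    rw [one_mul, hlam, measureReal_restrict_apply_univ]
  have hfub : ((∫ y, ‖D y‖ ^ 2 ∂μ : ℝ) : ℂ) = ∫ p : E × E,
      Complex.exp (((-⟪x, p.1 - p.2⟫ : ℝ) : ℂ) * Complex.I) * charFun μ (p.1 - p.2)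
        ∂(lam.prod lam) := by
    rw [← integral_complex_ofReal]
    simp_rw [hsq]
    rw [integral_integral_swap]
    · congr with p
      rw [charFun_apply, ← integral_const_mul]
      congr with y
      rw [← Complex.exp_add, ← add_mul, ← Complex.ofReal_add, inner_sub_left, neg_add_eq_sub]
    · refine Integrable.of_bound ?_ 1 (ae_of_all _ fun q => hexp _)
      apply Continuous.aestronglyMeasurable
      simp only [Function.uncurry_def]
      fun_prop
  have hupper : ∫ y, ‖D y‖ ^ 2 ∂μ ≤ v * J := by
    have hnonneg : 0 ≤ ∫ y, ‖D y‖ ^ 2 ∂μ := integral_nonneg fun _ => by positivity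
    have h1 : ∫ y, ‖D y‖ ^ 2 ∂μ = ‖((∫ y, ‖D y‖ ^ 2 ∂μ : ℝ) : ℂ)‖ := by
      rw [Complex.norm_real, Real.norm_of_nonneg hnonneg]
    have hcont : Continuous fun p : E × E => ‖charFun μ (p.1 - p.2)‖ := by
      have := continuous_charFun (μ := μ); fun_prop
    have hint : Integrable (fun p : E × E => ‖charFun μ (p.1 - p.2)‖) (lam.prod lam) :=
      Integrable.of_bound hcont.aestronglyMeasurable (μ.real univ) (ae_of_all _ fun p => by
        rw [norm_norm]; exact norm_charFun_le _)
    rw [h1, hfub]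
    calc _ ≤ ∫ p : E × E, ‖charFun μ (p.1 - p.2)‖ ∂(lam.prod lam) := by
          refine norm_integral_le_of_norm_le hint (ae_of_all _ fun p => ?_)
          rw [norm_mul, Complex.norm_exp_ofReal_mul_I, one_mul]
      _ = ∫ θ', ∫ θ, ‖charFun μ (θ - θ')‖ ∂lam ∂lam := integral_prod_symm _ hint
      _ ≤ ∫ _θ', J ∂lam := by
          refine setIntegral_mono_on hint.integral_prod_right (integrable_const _)
            measurableSet_closedBall fun θ' hθ' => ?_
          exact setIntegral_sub_le (continuous_charFun (μ := μ)).norm (fun _ => norm_nonneg _) hθ'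
      _ = v * J := by rw [hlam, setIntegral_const, smul_eq_mul]
  have hlower : (v / 2) ^ 2 * μ.real (Metric.closedBall x (1 / δ)) ≤ ∫ y, ‖D y‖ ^ 2 ∂μ := by
    refine le_trans ?_ (mul_meas_ge_le_integral_of_nonneg
      (ae_of_all _ fun y => by positivity) hintD ((v / 2) ^ 2))
    refine mul_le_mul_of_nonneg_left (measureReal_mono fun y hy => ?_) (by positivity)
    exact pow_le_pow_left₀ (by positivity) (half_volume_le_norm_integral_exp hδ
      (by simpa [dist_eq_norm] using hy)) 2
  have h := hlower.trans hupper
  rw [div_mul_eq_mul_div, le_div_iff₀ hvpos]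
  refine le_of_mul_le_mul_left ?_ hvpos
  nlinarith

end Smoothing

/-! ### The integral over frequencies -/

section Frequencies

variable {d : ℕ} {F : Measure (EuclideanSpace ℝ (Fin d))} {A : ℝ → ℝ}

lemma integrable_exp_neg_mul_norm_rpow (hd : 1 ≤ d) {c κ : ℝ} (hc : 0 < c) (hκ : 0 < κ) :
    Integrable fun η : EuclideanSpace ℝ (Fin d) => Real.exp (-c * ‖η‖ ^ κ) := by
  have : Nontrivial (EuclideanSpace ℝ (Fin d)) :=
    Module.nontrivial_of_finrank_pos (R := ℝ) (by rw [finrank_euclideanSpace_fin]; omega)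
  rw [integrable_fun_norm_addHaar volume (f := fun r : ℝ => Real.exp (-c * r ^ κ)),
    finrank_euclideanSpace_fin]
  have h := integrableOn_rpow_mul_exp_neg_mul_rpow (p := κ) (s := ((d - 1 : ℕ) : ℝ)) (b := c)
    (lt_of_lt_of_le (by norm_num) (Nat.cast_nonneg _)) hκ hc
  simpa only [Real.rpow_natCast, smul_eq_mul] using h

/-- With `a = a_n` one has `n / A(1 / r) ≥ (a r) ^ κ - 1`, and the integral scales like `a ^ (-d)`. -/
lemma IsScalingFunction.exists_integral_exp_le (hd : 1 ≤ d) (hA : IsScalingFunction F A)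
    {c : ℝ} (hc : 0 < c) :
    ∃ K : ℝ, 0 < K ∧ ∀ n : ℕ, n ≠ 0 →
      Integrable (fun η : EuclideanSpace ℝ (Fin d) => Real.exp (-c * (n / A (1 / ‖η‖)))) ∧
      ∫ η : EuclideanSpace ℝ (Fin d), Real.exp (-c * (n / A (1 / ‖η‖))) ≤
        K * scalingSeq A n ^ (-(d : ℤ)) := by
  obtain ⟨κ, hκ, hgrow⟩ := hA.exists_rpow_mul_le
  have hint := integrable_exp_neg_mul_norm_rpow hd hc hκ
  set I := ∫ η : EuclideanSpace ℝ (Fin d), Real.exp (-c * ‖η‖ ^ κ) with hI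
  have hI0 : 0 ≤ I := integral_nonneg fun _ => (Real.exp_pos _).le
  refine ⟨Real.exp c * I + 1, by positivity, fun n hn => ?_⟩
  obtain ⟨ha, haA⟩ := hA.scalingSeq_spec hn
  set a := scalingSeq A n with hadef
  have hpt : ∀ η : EuclideanSpace ℝ (Fin d), Real.exp (-c * (n / A (1 / ‖η‖))) ≤
      Real.exp c * Real.exp (-c * ‖a • η‖ ^ κ) := by
    intro η
    rw [← Real.exp_add, Real.exp_le_exp]
    have hkey : ‖a • η‖ ^ κ ≤ n / A (1 / ‖η‖) + 1 := by
      rw [norm_smul, Real.norm_of_nonneg ha.le]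
      have hA0 : 0 ≤ A (1 / ‖η‖) := by
        have := hA.mono le_rfl (show 0 ≤ 1 / ‖η‖ by positivity)
        rwa [hA.map_zero] at this
      rcases le_total (a * ‖η‖) 1 with h | h
      · have h1 := Real.rpow_le_one (by positivity) h hκ.le
        have : 0 ≤ n / A (1 / ‖η‖) := by positivity
        linarith
      · have hη : 0 < ‖η‖ := pos_of_mul_pos_right (lt_of_lt_of_le one_pos h) ha.le
        have hA1 := hA.pos (one_div_pos.2 hη)
        have h1 := hgrow (1 / ‖η‖) (a * ‖η‖) (one_div_pos.2 hη) h
        have h2 : a * ‖η‖ * (1 / ‖η‖) = a := by field_simp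
        rw [h2, haA, ← le_div_iff₀ hA1] at h1
        linarith
    nlinarith
  have hscaled : Integrable fun η : EuclideanSpace ℝ (Fin d) =>
      Real.exp c * Real.exp (-c * ‖a • η‖ ^ κ) := (hint.comp_smul ha.ne').const_mul _
  have hAmeas : Measurable fun η : EuclideanSpace ℝ (Fin d) => A (1 / ‖η‖) := by
    have hmono : Monotone fun r : ℝ => A (max r 0) := fun r r' h =>
      hA.mono (le_max_right _ _) (max_le_max h le_rfl)
    have := hmono.measurable.comp
      (show Measurable fun η : EuclideanSpace ℝ (Fin d) => 1 / ‖η‖ by fun_prop)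
    convert! this using 2 with η
    simp
  constructor
  · refine hscaled.mono'
      ((measurable_const.div hAmeas).const_mul (-c)).exp.aestronglyMeasurable (ae_of_all _ fun η => ?_)
    rw [Real.norm_of_nonneg (Real.exp_pos _).le]
    exact hpt η
  · calc _ ≤ ∫ η : EuclideanSpace ℝ (Fin d), Real.exp c * Real.exp (-c * ‖a • η‖ ^ κ) :=
          integral_mono_of_nonneg (ae_of_all _ fun _ => (Real.exp_pos _).le) hscaled
            (ae_of_all _ hpt)
      _ = Real.exp c * ((a ^ d)⁻¹ * I) := by
          rw [integral_const_mul, Measure.integral_comp_smul volume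
            (fun η : EuclideanSpace ℝ (Fin d) => Real.exp (-c * ‖η‖ ^ κ)) a,
            finrank_euclideanSpace_fin, abs_of_pos (by positivity), smul_eq_mul]
      _ ≤ (Real.exp c * I + 1) * a ^ (-(d : ℤ)) := by
          rw [zpow_neg, zpow_natCast]
          have : 0 < (a ^ d)⁻¹ := by positivity
          nlinarith

end Frequencies

/-! ### Exponential tilting -/

section Density

variable {E : Type*} [MeasurableSpace E]

lemma integral_withDensity_ofReal {H : Type*} [NormedAddCommGroup H] [NormedSpace ℝ H]
    {μ : Measure E} {w : E → ℝ} (hw : Measurable w) (hw0 : ∀ x, 0 ≤ w x) (g : E → H) :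
    ∫ x, g x ∂(μ.withDensity fun x => ENNReal.ofReal (w x)) = ∫ x, w x • g x ∂μ := by
  rw [integral_withDensity_eq_integral_toReal_smul (by fun_prop)
    (ae_of_all _ fun _ => ENNReal.ofReal_lt_top)]
  simp only [ENNReal.toReal_ofReal (hw0 _)]

lemma isFiniteMeasure_withDensity_ofReal_of_le {μ : Measure E} [IsFiniteMeasure μ] {w : E → ℝ}
    {C : ℝ} (hC : ∀ x, w x ≤ C) :
    IsFiniteMeasure (μ.withDensity fun x => ENNReal.ofReal (w x)) := by
  refine isFiniteMeasure_withDensity (ne_of_lt ?_)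
  calc ∫⁻ x, ENNReal.ofReal (w x) ∂μ ≤ ∫⁻ _, ENNReal.ofReal C ∂μ :=
        lintegral_mono fun x => ENNReal.ofReal_le_ofReal (hC x)
    _ < ⊤ := by
        rw [lintegral_const]
        exact ENNReal.mul_lt_top ENNReal.ofReal_lt_top (measure_lt_top _ _)

lemma charFun_map_sum_withDensity_prod [NormedAddCommGroup E] [InnerProductSpace ℝ E]
    [BorelSpace E] [SecondCountableTopology E] {F : Measure E} [IsProbabilityMeasure F]
    {w : E → ℝ} (hw : Measurable w) (hw0 : ∀ x, 0 ≤ w x) (n : ℕ) (θ : E) :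
    charFun (((Measure.pi fun _ : Fin n => F).withDensity
      fun x => ENNReal.ofReal (∏ i, w (x i))).map fun x => ∑ i, x i) θ =
      charFun (F.withDensity fun x => ENNReal.ofReal (w x)) θ ^ n := by
  rw [charFun_apply, charFun_apply, integral_map (by fun_prop) (by fun_prop),
    integral_withDensity_ofReal (by fun_prop) (fun x => Finset.prod_nonneg fun i _ => hw0 _),
    integral_withDensity_ofReal hw hw0]
  have h := integral_fintype_prod_eq_prod (μ := fun _ : Fin n => F)
    (fun _ x => w x • Complex.exp ((⟪x, θ⟫ : ℝ) * Complex.I))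
  rw [Finset.prod_const, Finset.card_univ, Fintype.card_fin] at h
  rw [← h]
  congr with x
  simp only [Complex.real_smul]
  rw [Finset.prod_mul_distrib, ← Complex.exp_sum, ← Finset.sum_mul, sum_inner]
  push_cast
  rfl

end Density

section Tilt

variable {d : ℕ} {F : Measure (EuclideanSpace ℝ (Fin d))} [IsProbabilityMeasure F] {A : ℝ → ℝ}
  {u : EuclideanSpace ℝ (Fin d)} {s : ℝ}

/-- The weight `exp (⟪x, u⟫ / s)` on the ball of radius `s`, zero outside. -/
noncomputable def tiltWeight (u : EuclideanSpace ℝ (Fin d)) (s : ℝ) (x : EuclideanSpace ℝ (Fin d)) : ℝ :=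
  {x | ‖x‖ ≤ s}.indicator (fun x => Real.exp (⟪x, u⟫ / s)) x

/-- The law `F` truncated to the ball of radius `s` and exponentially tilted in the direction `u`
at the scale `s`. It is not normalised. -/
noncomputable def tiltedMeasure (F : Measure (EuclideanSpace ℝ (Fin d))) (u : EuclideanSpace ℝ (Fin d)) (s : ℝ) :
    Measure (EuclideanSpace ℝ (Fin d)) :=
  F.withDensity fun x => ENNReal.ofReal (tiltWeight u s x)

lemma measurable_tiltWeight (u : EuclideanSpace ℝ (Fin d)) (s : ℝ) :
    Measurable (tiltWeight u s) :=
  (by fun_prop : Measurable fun x : EuclideanSpace ℝ (Fin d) =>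
    Real.exp (⟪x, u⟫ / s)).indicator (measurableSet_norm_le s)

lemma tiltWeight_nonneg (x : EuclideanSpace ℝ (Fin d)) : 0 ≤ tiltWeight u s x :=
  indicator_nonneg (fun _ _ => (Real.exp_pos _).le) x

lemma tiltWeight_of_le {x : EuclideanSpace ℝ (Fin d)} (hx : ‖x‖ ≤ s) :
    tiltWeight u s x = Real.exp (⟪x, u⟫ / s) :=
  indicator_of_mem (show x ∈ {x | ‖x‖ ≤ s} from hx) _

lemma abs_inner_div_le_one (hs : 0 < s) (hu : ‖u‖ ≤ 1) {x : EuclideanSpace ℝ (Fin d)}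
    (hx : ‖x‖ ≤ s) : |⟪x, u⟫ / s| ≤ 1 := by
  rw [abs_div, abs_of_pos hs, div_le_one hs]
  refine (abs_real_inner_le_norm x u).trans ?_
  exact (mul_le_of_le_one_right (norm_nonneg _) hu).trans hx

lemma tiltWeight_le (hs : 0 < s) (hu : ‖u‖ ≤ 1) (x : EuclideanSpace ℝ (Fin d)) :
    tiltWeight u s x ≤ Real.exp 1 := by
  by_cases hx : ‖x‖ ≤ s
  · rw [tiltWeight_of_le hx, Real.exp_le_exp]
    exact (abs_le.1 (abs_inner_div_le_one hs hu hx)).2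
  · rw [tiltWeight, indicator_of_notMem (show x ∉ {x | ‖x‖ ≤ s} from hx)]
    positivity

lemma isFiniteMeasure_tiltedMeasure (F : Measure (EuclideanSpace ℝ (Fin d)))
    [IsProbabilityMeasure F] (hs : 0 < s) (hu : ‖u‖ ≤ 1) :
    IsFiniteMeasure (tiltedMeasure F u s) :=
  isFiniteMeasure_withDensity_ofReal_of_le (tiltWeight_le hs hu)

lemma tiltedMeasure_real_univ (F : Measure (EuclideanSpace ℝ (Fin d))) [IsProbabilityMeasure F]
    (u : EuclideanSpace ℝ (Fin d)) (s : ℝ) :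
    (tiltedMeasure F u s).real univ = ∫ x, tiltWeight u s x ∂F := by
  have h := integral_withDensity_ofReal (μ := F) (measurable_tiltWeight u s)
    (fun x => tiltWeight_nonneg x) (fun _ => (1 : ℝ))
  rw [integral_const] at h
  simpa [tiltedMeasure] using h

lemma integrable_tiltWeight (F : Measure (EuclideanSpace ℝ (Fin d))) [IsProbabilityMeasure F]
    (hs : 0 < s) (hu : ‖u‖ ≤ 1) : Integrable (tiltWeight u s) F :=
  Integrable.of_bound (measurable_tiltWeight u s).aestronglyMeasurable (Real.exp 1)
    (ae_of_all _ fun x => by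
      rw [Real.norm_of_nonneg (tiltWeight_nonneg x)]; exact tiltWeight_le hs hu x)

lemma tiltedMeasure_real_univ_le_exp_one (hs : 0 < s) (hu : ‖u‖ ≤ 1) :
    (tiltedMeasure F u s).real univ ≤ Real.exp 1 := by
  rw [tiltedMeasure_real_univ]
  calc ∫ x, tiltWeight u s x ∂F ≤ ∫ _, Real.exp 1 ∂F :=
        integral_mono (integrable_tiltWeight F hs hu) (integrable_const _) (tiltWeight_le hs hu)
    _ = Real.exp 1 := by simp

/-- Second order expansion of the mass of the tilted law. -/
lemma tiltedMeasure_real_univ_le (hs : 0 < s) (hu : ‖u‖ ≤ 1) :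
    (tiltedMeasure F u s).real univ ≤
      1 + ‖∫ x in {x | ‖x‖ ≤ s}, x ∂F‖ / s + truncSecondMoment F s / s ^ 2 := by
  have hB := measurableSet_norm_le (d := d) s
  have hlin : IntegrableOn (fun x => (⟪u, x⟫ : ℝ) / s) {x | ‖x‖ ≤ s} F :=
    ((integrableOn_id F s).const_inner u).div_const s
  have hquad : IntegrableOn (fun x : EuclideanSpace ℝ (Fin d) => ‖x‖ ^ 2 / s ^ 2)
      {x | ‖x‖ ≤ s} F := (integrableOn_norm_sq F s).div_const _
  have hone : IntegrableOn (fun _ : EuclideanSpace ℝ (Fin d) => (1 : ℝ)) {x | ‖x‖ ≤ s} F :=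
    integrableOn_const (measure_ne_top _ _)
  have hsum : IntegrableOn (fun x => 1 + (⟪u, x⟫ : ℝ) / s) {x | ‖x‖ ≤ s} F := hone.add hlin
  have hexp : IntegrableOn (fun x => Real.exp (⟪x, u⟫ / s)) {x | ‖x‖ ≤ s} F :=
    (integrable_indicator_iff hB).1 (integrable_tiltWeight F hs hu)
  have hmass : F.real {x | ‖x‖ ≤ s} ≤ 1 := measureReal_le_one
  have hmean : ⟪u, ∫ x in {x | ‖x‖ ≤ s}, x ∂F⟫ / s ≤ ‖∫ x in {x | ‖x‖ ≤ s}, x ∂F‖ / s := by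
    refine div_le_div_of_nonneg_right ((real_inner_le_norm _ _).trans ?_) hs.le
    exact mul_le_of_le_one_left (norm_nonneg _) hu
  rw [tiltedMeasure_real_univ]
  unfold tiltWeight
  rw [integral_indicator hB]
  calc ∫ x in {x | ‖x‖ ≤ s}, Real.exp (⟪x, u⟫ / s) ∂F
      ≤ ∫ x in {x | ‖x‖ ≤ s}, (1 + ⟪u, x⟫ / s + ‖x‖ ^ 2 / s ^ 2) ∂F := by
        refine setIntegral_mono_on hexp (hsum.add hquad) hB fun x hx => ?_
        have h1 := (abs_le.1 (Real.abs_exp_sub_one_sub_id_le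
          (abs_inner_div_le_one hs hu hx))).2
        have h2 : (⟪x, u⟫ / s) ^ 2 ≤ ‖x‖ ^ 2 / s ^ 2 := by
          rw [div_pow]
          refine div_le_div_of_nonneg_right ?_ (by positivity)
          rw [← sq_abs]
          refine pow_le_pow_left₀ (abs_nonneg _) ((abs_real_inner_le_norm x u).trans ?_) 2
          exact mul_le_of_le_one_right (norm_nonneg _) hu
        rw [real_inner_comm x u]
        linarith
    _ = F.real {x | ‖x‖ ≤ s} + ⟪u, ∫ x in {x | ‖x‖ ≤ s}, x ∂F⟫ / s +
          truncSecondMoment F s / s ^ 2 := by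
        rw [integral_add hsum hquad, integral_add hone hlin, integral_div, integral_div,
          integral_inner (integrableOn_id F s), truncSecondMoment]
        simp
    _ ≤ _ := by linarith

/-- Tilting and truncation keep a fixed proportion of the gap between the mass and the modulus of
the characteristic function, up to the tail. -/
lemma norm_charFun_tiltedMeasure_le (hs : 0 < s) (hu : ‖u‖ ≤ 1)
    (θ : EuclideanSpace ℝ (Fin d)) :
    ‖charFun (tiltedMeasure F u s) θ‖ ≤ (tiltedMeasure F u s).real univ -
      Real.exp (-1) * (1 - ‖charFun F θ‖ - 2 * F.real {x | s < ‖x‖}) := by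
  have hB := measurableSet_norm_le (d := d) s
  have := isFiniteMeasure_tiltedMeasure F hs hu
  obtain ⟨β, hβ⟩ := exists_norm_charFun_eq (tiltedMeasure F u s) θ
  have hcos := integrable_cos_inner_sub F θ β
  have hgap0 : ∀ x, 0 ≤ 1 - Real.cos (⟪x, θ⟫ - β) := fun x => sub_nonneg.2 (Real.cos_le_one _)
  have hgap : Integrable (fun x => 1 - Real.cos (⟪x, θ⟫ - β)) F := (integrable_const _).sub hcos
  have hw := integrable_tiltWeight F hs hu
  have hwcos : Integrable (fun x => tiltWeight u s x * Real.cos (⟪x, θ⟫ - β)) F :=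
    hw.mul_of_top_left (memLp_top_of_bound hcos.aestronglyMeasurable 1
      (ae_of_all _ fun x => Real.abs_cos_le_one _))
  have hkey : Real.exp (-1) * ∫ x in {x | ‖x‖ ≤ s}, (1 - Real.cos (⟪x, θ⟫ - β)) ∂F ≤
      (tiltedMeasure F u s).real univ - ‖charFun (tiltedMeasure F u s) θ‖ := by
    rw [hβ, tiltedMeasure_real_univ, tiltedMeasure,
      integral_withDensity_ofReal (measurable_tiltWeight u s) fun x => tiltWeight_nonneg x]
    simp only [smul_eq_mul]
    rw [← integral_sub hw hwcos, ← integral_const_mul, ← integral_indicator hB]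
    refine integral_mono ((integrable_indicator_iff hB).2 (hgap.const_mul _).integrableOn)
      (hw.sub hwcos) fun x => ?_
    have hfac : tiltWeight u s x - tiltWeight u s x * Real.cos (⟪x, θ⟫ - β) =
        tiltWeight u s x * (1 - Real.cos (⟪x, θ⟫ - β)) := by ring
    simp only [hfac]
    by_cases hx : ‖x‖ ≤ s
    · rw [indicator_of_mem (show x ∈ {x | ‖x‖ ≤ s} from hx), tiltWeight_of_le hx]
      refine mul_le_mul_of_nonneg_right (Real.exp_le_exp.2 ?_) (hgap0 x)
      exact (abs_le.1 (abs_inner_div_le_one hs hu hx)).1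
    · rw [indicator_of_notMem (show x ∉ {x | ‖x‖ ≤ s} from hx)]
      exact mul_nonneg (tiltWeight_nonneg x) (hgap0 x)
  have hsplit := integral_add_compl hB hgap
  have htail : ∫ x in {x | ‖x‖ ≤ s}ᶜ, (1 - Real.cos (⟪x, θ⟫ - β)) ∂F ≤
      2 * F.real {x | s < ‖x‖} := by
    rw [compl_norm_le]
    refine (le_abs_self _).trans (norm_setIntegral_le_of_norm_le_const
      (f := fun x => 1 - Real.cos (⟪x, θ⟫ - β)) (measure_lt_top _ _) fun x _ => ?_)
    rw [Real.norm_of_nonneg (hgap0 x)]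
    linarith [Real.neg_one_le_cos (⟪x, θ⟫ - β)]
  have hfull : 1 - ‖charFun F θ‖ ≤ ∫ x, (1 - Real.cos (⟪x, θ⟫ - β)) ∂F := by
    rw [integral_sub (integrable_const _) hcos]
    have := integral_cos_le_norm_charFun F θ β
    simp only [integral_const, probReal_univ, smul_eq_mul, mul_one]
    linarith
  have hexp : 0 < Real.exp (-1) := Real.exp_pos _
  nlinarith

/-- The tilted laws have mass `exp (O(1 / A(s)))`, and their characteristic functions decay like
`exp (-c / A(1 / ‖θ‖))` relative to the mass, at the frequencies between `R / s` and a fixed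
bound. -/
lemma InDomainOfAttractionWithoutCentering.exists_tilted_bounds {α : ℝ} (hd : 1 ≤ d) (hα : 0 < α)
    (hF : InDomainOfAttractionWithoutCentering α F) (hA : IsScalingFunction F A) :
    ∃ c C R ρ s₀ : ℝ, 0 < c ∧ 0 < C ∧ 0 < R ∧ 0 < ρ ∧ 0 < s₀ ∧
      ∀ (s : ℝ) (u : EuclideanSpace ℝ (Fin d)), s₀ ≤ s → ‖u‖ ≤ 1 →
        (tiltedMeasure F u s).real univ ≤ Real.exp (C / A s) ∧
        ∀ θ, R / s ≤ ‖θ‖ → ‖θ‖ ≤ ρ → ‖charFun (tiltedMeasure F u s) θ‖ ≤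
          (tiltedMeasure F u s).real univ * Real.exp (-c / A (1 / ‖θ‖)) := by
  obtain ⟨c, C, t₀, hc, hC, ht₀, hmain⟩ := hF.exists_bounds hd hα hA
  obtain ⟨s₁, hs₁, hV⟩ := hA.exists_mul_truncSecondMoment
  obtain ⟨C₁, s₂, hC₁, hs₂, hT⟩ := hA.exists_tail_le
  obtain ⟨κ, hκ, hgrow⟩ := hA.exists_rpow_mul_le
  -- For `s ≥ R t` the tail beyond `s` is at most half of the gap `c / A t`.
  set R : ℝ := max 1 ((4 * C₁ / c) ^ κ⁻¹) with hR
  have hR0 : 0 < R := lt_of_lt_of_le one_pos (le_max_left _ _)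
  refine ⟨Real.exp (-1) * Real.exp (-1) * (c / 2), C + 2, R, 1 / t₀, max t₀ (max s₁ s₂),
    by positivity, by positivity, hR0, by positivity, by positivity, fun s u hs hu => ?_⟩
  have hst : t₀ ≤ s := (le_max_left _ _).trans hs
  have hs1 : s₁ ≤ s := ((le_max_left _ _).trans (le_max_right _ _)).trans hs
  have hs2 : s₂ ≤ s := ((le_max_right _ _).trans (le_max_right _ _)).trans hs
  have hs0 : 0 < s := ht₀.trans_le hst
  have hAs := hA.pos hs0
  constructor
  · refine (tiltedMeasure_real_univ_le hs0 hu).trans (le_trans ?_ (Real.add_one_le_exp _))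
    have h1 : ‖∫ x in {x | ‖x‖ ≤ s}, x ∂F‖ / s ≤ C / A s := (div_le_iff₀ hs0).2 (hmain s hst).2
    have h2 : truncSecondMoment F s / s ^ 2 ≤ 2 / A s := by
      rw [div_le_div_iff₀ (by positivity) hAs]
      linarith [(hV s hs1).2]
    have h3 : (C + 2) / A s = C / A s + 2 / A s := add_div _ _ _
    linarith
  · intro θ hθ1 hθ2
    have hθ0 : 0 < ‖θ‖ := lt_of_lt_of_le (by positivity) hθ1
    set t := 1 / ‖θ‖ with ht
    have htpos : 0 < t := by positivity
    have htt₀ : t₀ ≤ t := by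
      rw [ht, le_div_iff₀ hθ0]
      rw [le_div_iff₀ ht₀] at hθ2
      linarith
    have hRt : R ≤ s / t := by
      rw [ht, div_div_eq_mul_div, div_one]
      rw [div_le_iff₀ hs0] at hθ1
      linarith
    have hAt := hA.pos htpos
    have hlow := (hmain t htt₀).1 θ (by rw [ht, one_div_one_div])
    have hAst : 4 * C₁ / c * A t ≤ A s := by
      have h1 := hgrow t (s / t) htpos ((le_max_left _ _).trans hRt)
      rw [div_mul_cancel₀ _ htpos.ne'] at h1
      refine le_trans (mul_le_mul_of_nonneg_right ?_ hAt.le) h1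
      refine (Real.rpow_inv_le_iff_of_pos (by positivity) (by positivity) hκ).1 ?_
      exact (le_max_right _ _).trans hRt
    have htail : 2 * F.real {x | s < ‖x‖} ≤ c / 2 / A t := by
      have h1 : 2 * (C₁ / A s) ≤ c / 2 / A t := by
        rw [mul_div_assoc', div_le_div_iff₀ hAs hAt]
        have h2 : 4 * C₁ / c * A t * c = 4 * C₁ * A t := by field_simp
        nlinarith
      linarith [hT s hs2]
    have hgap : c / 2 / A t ≤ 1 - ‖charFun F θ‖ - 2 * F.real {x | s < ‖x‖} := by
      have : c / A t = c / 2 / A t + c / 2 / A t := by ring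
      linarith
    set M := (tiltedMeasure F u s).real univ with hM
    have hM1 : M ≤ Real.exp 1 := tiltedMeasure_real_univ_le_exp_one hs0 hu
    have hM0 : 0 ≤ M := measureReal_nonneg
    have hMe : M * Real.exp (-1) ≤ 1 := by
      calc M * Real.exp (-1) ≤ Real.exp 1 * Real.exp (-1) :=
            mul_le_mul_of_nonneg_right hM1 (Real.exp_pos _).le
        _ = 1 := by rw [← Real.exp_add]; simp
    have hy : 0 ≤ Real.exp (-1) * (c / 2 / A t) := by positivity
    have h1 := Real.add_one_le_exp (-(Real.exp (-1) * Real.exp (-1) * (c / 2)) / A t)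
    refine (norm_charFun_tiltedMeasure_le hs0 hu θ).trans (le_trans ?_
      (mul_le_mul_of_nonneg_left h1 hM0))
    have h2 : M * (-(Real.exp (-1) * Real.exp (-1) * (c / 2)) / A t + 1) =
        M - (M * Real.exp (-1)) * (Real.exp (-1) * (c / 2 / A t)) := by ring
    rw [h2]
    have h3 := mul_le_mul_of_nonneg_right hMe hy
    have h4 := mul_le_mul_of_nonneg_left hgap (Real.exp_pos (-1)).le
    linarith

end Tilt

/-! ### Cells and running maxima -/

section Geometry

variable {d : ℕ}

lemma norm_sub_le_of_mem_cell {x y : EuclideanSpace ℝ (Fin d)} {h : ℝ} (hh : 0 ≤ h)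
    (hy : y ∈ cell x h) : ‖y - x‖ ≤ h * √d := by
  obtain ⟨z, hz, rfl⟩ := hy
  simp only [add_sub_cancel_left]
  rw [norm_smul, Real.norm_of_nonneg hh, EuclideanSpace.norm_eq]
  refine mul_le_mul_of_nonneg_left (Real.sqrt_le_sqrt ?_) hh
  calc ∑ i, ‖z i‖ ^ 2 ≤ ∑ _i : Fin d, (1 : ℝ) := Finset.sum_le_sum fun i _ => by
        rw [Real.norm_of_nonneg (hz i).1]
        exact pow_le_one₀ (hz i).1 (hz i).2.le
    _ = d := by simp

lemma norm_le_runningMax {E : Type*} [Norm E] (x : ℕ → E) {n i : ℕ} (hi : i < n) :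
    ‖x i‖ ≤ runningMax x n := by
  induction n with
  | zero => omega
  | succ n ih =>
    rcases Nat.lt_succ_iff_lt_or_eq.1 hi with h | rfl
    · exact (ih h).trans (le_max_left _ _)
    · exact le_max_right _ _

end Geometry

/-! ### The local bound -/

section LocalBound

variable {d : ℕ} {F : Measure (EuclideanSpace ℝ (Fin d))} [IsProbabilityMeasure F] {A : ℝ → ℝ}

/-- The distribution of the sum of `n` vectors distributed according to the unnormalised
tilted law. -/
noncomputable def tiltedSum (F : Measure (EuclideanSpace ℝ (Fin d)))
    (u : EuclideanSpace ℝ (Fin d)) (s : ℝ) (n : ℕ) : Measure (EuclideanSpace ℝ (Fin d)) :=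
  ((Measure.pi fun _ : Fin n => F).withDensity
    fun y => ENNReal.ofReal (∏ i, tiltWeight u s (y i))).map fun y => ∑ i, y i

lemma prod_tiltWeight_le {u : EuclideanSpace ℝ (Fin d)} {s : ℝ} (hs : 0 < s) (hu : ‖u‖ ≤ 1) {n : ℕ}
    (y : Fin n → EuclideanSpace ℝ (Fin d)) :
    ∏ i, tiltWeight u s (y i) ≤ Real.exp 1 ^ n := by
  have h := Finset.prod_le_prod (s := Finset.univ)
    (fun i _ => tiltWeight_nonneg (u := u) (s := s) (y i)) fun i _ => tiltWeight_le hs hu (y i)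
  simpa using h

lemma measurable_prod_tiltWeight (u : EuclideanSpace ℝ (Fin d)) (s : ℝ) (n : ℕ) :
    Measurable fun y : Fin n → EuclideanSpace ℝ (Fin d) => ∏ i, tiltWeight u s (y i) :=
  Finset.measurable_fun_prod _ fun i _ => (measurable_tiltWeight u s).comp (measurable_pi_apply i)

lemma isFiniteMeasure_tiltedSum (F : Measure (EuclideanSpace ℝ (Fin d))) [IsProbabilityMeasure F]
    {u : EuclideanSpace ℝ (Fin d)} {s : ℝ} (hs : 0 < s) (hu : ‖u‖ ≤ 1) (n : ℕ) :
    IsFiniteMeasure (tiltedSum F u s n) := by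
  have := isFiniteMeasure_withDensity_ofReal_of_le (μ := Measure.pi fun _ : Fin n => F)
    (prod_tiltWeight_le (n := n) hs hu)
  unfold tiltedSum
  infer_instance

/-- Change of measure. Where the sum lies within `ρ` of `x` and no term exceeds `s`, the product of
the weights is at least `exp ((‖x‖ - ρ) / s)`. -/
lemma measureReal_pi_le_tiltedSum {u x : EuclideanSpace ℝ (Fin d)} {s ρ : ℝ} (hs : 0 < s)
    (hu : ‖u‖ ≤ 1) (hux : ⟪x, u⟫ = ‖x‖) (n : ℕ) :
    (Measure.pi fun _ : Fin n => F).real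
        {y | ∑ i, y i ∈ Metric.closedBall x ρ ∧ ∀ i, ‖y i‖ ≤ s} ≤
      Real.exp ((ρ - ‖x‖) / s) * (tiltedSum F u s n).real (Metric.closedBall x ρ) := by
  set Q := Measure.pi fun _ : Fin n => F with hQ
  set W : (Fin n → EuclideanSpace ℝ (Fin d)) → ℝ := fun y => ∏ i, tiltWeight u s (y i) with hW
  have hWm : Measurable W := measurable_prod_tiltWeight u s n
  have hW0 : ∀ y, 0 ≤ W y := fun y => Finset.prod_nonneg fun i _ => tiltWeight_nonneg _
  have hSm : Measurable fun y : Fin n → EuclideanSpace ℝ (Fin d) => ∑ i, y i := by fun_prop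
  set T := (fun y : Fin n → EuclideanSpace ℝ (Fin d) => ∑ i, y i) ⁻¹' Metric.closedBall x ρ
    with hT
  have hTm : MeasurableSet T := hSm measurableSet_closedBall
  set U := {y : Fin n → EuclideanSpace ℝ (Fin d) |
    ∑ i, y i ∈ Metric.closedBall x ρ ∧ ∀ i, ‖y i‖ ≤ s} with hU
  have hUm : MeasurableSet U := by
    have : U = T ∩ ⋂ i, (fun y : Fin n → EuclideanSpace ℝ (Fin d) => y i) ⁻¹' {x | ‖x‖ ≤ s} := by
      ext y; simp [hU, hT]
    rw [this]
    exact hTm.inter (MeasurableSet.iInter fun i =>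
      (measurable_pi_apply i) (measurableSet_norm_le s))
  have hWint : Integrable W Q :=
    Integrable.of_bound hWm.aestronglyMeasurable (Real.exp 1 ^ n) (ae_of_all _ fun y => by
      rw [Real.norm_of_nonneg (hW0 y)]; exact prod_tiltWeight_le hs hu y)
  have hval : (tiltedSum F u s n).real (Metric.closedBall x ρ) = ∫ y in T, W y ∂Q := by
    rw [measureReal_def, tiltedSum, Measure.map_apply hSm measurableSet_closedBall,
      withDensity_apply _ hTm, integral_eq_lintegral_of_nonneg_ae (ae_of_all _ hW0)
        hWm.aestronglyMeasurable]
  have hlow : Real.exp ((‖x‖ - ρ) / s) * Q.real U ≤ ∫ y in T, W y ∂Q := by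
    calc Real.exp ((‖x‖ - ρ) / s) * Q.real U = ∫ _ in U, Real.exp ((‖x‖ - ρ) / s) ∂Q := by
          rw [setIntegral_const, smul_eq_mul, mul_comm]
      _ ≤ ∫ y in U, W y ∂Q := by
          refine setIntegral_mono_on (integrable_const _) hWint.integrableOn hUm fun y hy => ?_
          have hWy : W y = Real.exp (⟪∑ i, y i, u⟫ / s) := by
            rw [sum_inner, Finset.sum_div, Real.exp_sum]
            exact Finset.prod_congr rfl fun i _ => tiltWeight_of_le (hy.2 i)
          rw [hWy, Real.exp_le_exp]
          refine div_le_div_of_nonneg_right ?_ hs.le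
          have h1 : ‖∑ i, y i - x‖ ≤ ρ := by simpa [dist_eq_norm] using hy.1
          have h2 := (abs_le.1 (abs_real_inner_le_norm (∑ i, y i - x) u)).1
          have h3 : ‖∑ i, y i - x‖ * ‖u‖ ≤ ρ :=
            (mul_le_of_le_one_right (norm_nonneg _) hu).trans h1
          rw [inner_sub_left, hux] at h2
          linarith
      _ ≤ ∫ y in T, W y ∂Q :=
          setIntegral_mono_set hWint.integrableOn (ae_of_all _ hW0)
            (LE.le.eventuallyLE fun y hy => hy.1)
  rw [hval]
  calc Q.real U = Real.exp ((ρ - ‖x‖) / s) * (Real.exp ((‖x‖ - ρ) / s) * Q.real U) := by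
        rw [← mul_assoc, ← Real.exp_add, ← add_div]
        simp
    _ ≤ _ := mul_le_mul_of_nonneg_left hlow (Real.exp_pos _).le

/-- The smoothing inequality applied to the tilted sum. Frequencies below `R / s` contribute
`s ^ (-d)`, the others `a_n ^ (-d)`. -/
lemma InDomainOfAttractionWithoutCentering.exists_tiltedSum_le {α : ℝ} (hd : 1 ≤ d) (hα : 0 < α)
    (hF : InDomainOfAttractionWithoutCentering α F) (hA : IsScalingFunction F A) :
    ∃ C s₀ : ℝ, 0 < C ∧ 0 < s₀ ∧ ∀ ρ : ℝ, 0 < ρ → ∃ K : ℝ, 0 < K ∧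
      ∀ (s : ℝ) (u x : EuclideanSpace ℝ (Fin d)) (n : ℕ), s₀ ≤ s → ‖u‖ ≤ 1 → n ≠ 0 →
        (tiltedSum F u s n).real (Metric.closedBall x ρ) ≤
          K * ((s ^ (-(d : ℤ)) + scalingSeq A n ^ (-(d : ℤ))) * Real.exp (C * n / A s)) := by
  obtain ⟨c, C, R, ρ₀, s₀, hc, hC, hR, hρ₀, hs₀, hbd⟩ := hF.exists_tilted_bounds hd hα hA
  obtain ⟨K₁, hK₁, hfreq⟩ := hA.exists_integral_exp_le (d := d) hd hc
  refine ⟨C, s₀, hC, hs₀, fun ρ hρ => ?_⟩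
  -- The frequencies up to `2 δ` stay below `ρ₀`, and `closedBall x ρ ⊆ closedBall x (1 / δ)`.
  set δ : ℝ := min (ρ₀ / 2) (1 / ρ) with hδ
  have hδ0 : 0 < δ := by positivity
  have hδρ : ρ ≤ 1 / δ := by
    rw [le_div_iff₀ hδ0]
    calc ρ * δ ≤ ρ * (1 / ρ) := mul_le_mul_of_nonneg_left (min_le_right _ _) hρ.le
      _ = 1 := by field_simp
  set v := volume.real (Metric.closedBall (0 : EuclideanSpace ℝ (Fin d)) δ) with hv
  have hv0 : 0 < v :=
    ENNReal.toReal_pos (Metric.measure_closedBall_pos volume 0 hδ0).ne'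
      measure_closedBall_lt_top.ne
  set v₁ := volume.real (Metric.ball (0 : EuclideanSpace ℝ (Fin d)) 1) with hv₁
  have hv₁0 : 0 ≤ v₁ := measureReal_nonneg
  refine ⟨4 / v * (R ^ d * v₁ + K₁), by positivity, fun s u x n hs hu hn => ?_⟩
  have hs0 : 0 < s := hs₀.trans_le hs
  obtain ⟨hmass, hdecay⟩ := hbd s u hs hu
  have hfin := isFiniteMeasure_tiltedSum F hs0 hu n
  have hfin' := isFiniteMeasure_tiltedMeasure F hs0 hu
  set M := (tiltedMeasure F u s).real univ with hM
  have hM0 : 0 ≤ M := measureReal_nonneg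
  obtain ⟨hJint, hJ⟩ := hfreq n hn
  set g : EuclideanSpace ℝ (Fin d) → ℝ := fun η => Real.exp (-c * (n / A (1 / ‖η‖))) with hg
  have hg0 : ∀ η, 0 ≤ g η := fun η => (Real.exp_pos _).le
  set low := Metric.closedBall (0 : EuclideanSpace ℝ (Fin d)) (R / s) with hlow
  have hlowint : Integrable (low.indicator fun _ : EuclideanSpace ℝ (Fin d) => (1 : ℝ)) volume :=
    (integrable_indicator_iff measurableSet_closedBall).2
      (integrableOn_const measure_closedBall_lt_top.ne)
  have hmajor : Integrable (fun η => M ^ n * (low.indicator (fun _ => (1 : ℝ)) η + g η)) volume :=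
    (hlowint.add hJint).const_mul _
  have hlow0 : ∀ η, 0 ≤ low.indicator (fun _ => (1 : ℝ)) η :=
    fun η => indicator_nonneg (fun _ _ => zero_le_one) η
  have hpt : ∀ η ∈ Metric.closedBall (0 : EuclideanSpace ℝ (Fin d)) (2 * δ),
      ‖charFun (tiltedSum F u s n) η‖ ≤ M ^ n * (low.indicator (fun _ => (1 : ℝ)) η + g η) := by
    intro η hη
    rw [tiltedSum, charFun_map_sum_withDensity_prod (measurable_tiltWeight u s)
      (fun x => tiltWeight_nonneg x), norm_pow]
    change ‖charFun (tiltedMeasure F u s) η‖ ^ n ≤ _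
    by_cases h : η ∈ low
    · rw [indicator_of_mem h]
      calc _ ≤ M ^ n := pow_le_pow_left₀ (norm_nonneg _) (norm_charFun_le η) n
        _ ≤ _ := le_mul_of_one_le_right (by positivity) (by linarith [hg0 η])
    · rw [indicator_of_notMem h, zero_add]
      have h1 : R / s ≤ ‖η‖ := by
        rw [hlow, mem_closedBall_zero_iff, not_le] at h
        exact h.le
      have h2 : ‖η‖ ≤ ρ₀ := by
        rw [mem_closedBall_zero_iff] at hη
        linarith [min_le_left (ρ₀ / 2) (1 / ρ)]
      refine (pow_le_pow_left₀ (norm_nonneg _) (hdecay η h1 h2) n).trans_eq ?_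
      rw [mul_pow, ← Real.exp_nat_mul, hg]
      congr 2
      ring
  have hintegral : ∫ η in Metric.closedBall (0 : EuclideanSpace ℝ (Fin d)) (2 * δ),
      ‖charFun (tiltedSum F u s n) η‖ ≤
        M ^ n * ((R / s) ^ d * v₁ + K₁ * scalingSeq A n ^ (-(d : ℤ))) := by
    calc _ ≤ ∫ η in Metric.closedBall (0 : EuclideanSpace ℝ (Fin d)) (2 * δ),
          M ^ n * (low.indicator (fun _ => (1 : ℝ)) η + g η) :=
          setIntegral_mono_on ((continuous_charFun.norm.continuousOn).integrableOn_compact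
            (isCompact_closedBall _ _)) hmajor.integrableOn measurableSet_closedBall hpt
      _ ≤ ∫ η, M ^ n * (low.indicator (fun _ => (1 : ℝ)) η + g η) :=
          setIntegral_le_integral hmajor (ae_of_all _ fun η =>
            mul_nonneg (by positivity) (add_nonneg (hlow0 η) (hg0 η)))
      _ = M ^ n * ((R / s) ^ d * v₁ + ∫ η, g η) := by
          rw [integral_const_mul, integral_add hlowint hJint,
            integral_indicator measurableSet_closedBall, setIntegral_const,
            Measure.addHaar_real_closedBall _ _ (by positivity), finrank_euclideanSpace_fin]
          simp [hv₁]
      _ ≤ _ := by gcongr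
  have hMn : M ^ n ≤ Real.exp (C * n / A s) := by
    refine (pow_le_pow_left₀ hM0 hmass n).trans_eq ?_
    rw [← Real.exp_nat_mul]
    congr 1
    ring
  have hball := measureReal_closedBall_le (tiltedSum F u s n) x hδ0
  have hmono : (tiltedSum F u s n).real (Metric.closedBall x ρ) ≤
      (tiltedSum F u s n).real (Metric.closedBall x (1 / δ)) :=
    measureReal_mono (Metric.closedBall_subset_closedBall hδρ)
  have ha := hA.scalingSeq_pos n
  have hsd : (R / s) ^ d = R ^ d * s ^ (-(d : ℤ)) := by
    rw [div_pow, zpow_neg, zpow_natCast, div_eq_mul_inv]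
  have hsd0 : 0 < s ^ (-(d : ℤ)) := zpow_pos hs0 _
  have had0 : 0 < scalingSeq A n ^ (-(d : ℤ)) := zpow_pos ha _
  calc _ ≤ _ := hmono
    _ ≤ _ := hball
    _ ≤ 4 / v * (M ^ n * ((R / s) ^ d * v₁ + K₁ * scalingSeq A n ^ (-(d : ℤ)))) :=
        mul_le_mul_of_nonneg_left hintegral (by positivity)
    _ ≤ 4 / v * (Real.exp (C * n / A s) * ((R ^ d * v₁ + K₁) *
          (s ^ (-(d : ℤ)) + scalingSeq A n ^ (-(d : ℤ))))) := by
        refine mul_le_mul_of_nonneg_left (mul_le_mul hMn ?_ ?_ (Real.exp_pos _).le) (by positivity)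
        · rw [hsd]
          have h1 : 0 ≤ R ^ d * v₁ := by positivity
          nlinarith [mul_nonneg h1 had0.le, mul_pos hK₁ hsd0]
        · positivity
    _ = _ := by ring

lemma exists_inner_eq_norm (x : EuclideanSpace ℝ (Fin d)) :
    ∃ u : EuclideanSpace ℝ (Fin d), ‖u‖ ≤ 1 ∧ ⟪x, u⟫ = ‖x‖ := by
  rcases eq_or_ne x 0 with rfl | hx
  · exact ⟨0, by simp, by simp⟩
  · have hx' : 0 < ‖x‖ := norm_pos_iff.2 hx
    refine ⟨‖x‖⁻¹ • x, ?_, ?_⟩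
    · rw [norm_smul, norm_inv, norm_norm, inv_mul_cancel₀ hx'.ne']
    · rw [real_inner_smul_right, real_inner_self_eq_norm_sq]
      field_simp

end LocalBound

/-- The event depends only on the joint law of the first `n` terms, which is a product measure. A
cell of side `h` lies in a ball of radius `h √d`. -/
lemma measureReal_cell_le_pi {d : ℕ} {F : Measure (EuclideanSpace ℝ (Fin d))} {Ω : Type*}
    [MeasurableSpace Ω] {P : Measure Ω} [IsProbabilityMeasure P]
    {X : ℕ → Ω → EuclideanSpace ℝ (Fin d)} (hind : iIndepFun X P) (hlaw : ∀ i, HasLaw (X i) F P)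
    (x : EuclideanSpace ℝ (Fin d)) {h : ℝ} (hh : 0 ≤ h) (s : ℝ) (n : ℕ) :
    P.real {ω | partialSum (fun i => X i ω) n ∈ cell x h ∧ runningMax (fun i => X i ω) n ≤ s} ≤
      (Measure.pi fun _ : Fin n => F).real
        {y | ∑ i, y i ∈ Metric.closedBall x (h * √d) ∧ ∀ i, ‖y i‖ ≤ s} := by
  have hmeas : ∀ i : Fin n, AEMeasurable (X i) P := fun i => (hlaw i).aemeasurable
  have hmap : P.map (fun ω (i : Fin n) => X i ω) = Measure.pi fun _ : Fin n => F := by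
    rw [(hind.precomp Fin.val_injective).map_fun_eq_pi_map hmeas]
    congr with i : 1
    exact (hlaw i).map_eq
  have hU : MeasurableSet {y : Fin n → EuclideanSpace ℝ (Fin d) |
      ∑ i, y i ∈ Metric.closedBall x (h * √d) ∧ ∀ i, ‖y i‖ ≤ s} := by
    have h1 : Measurable fun y : Fin n → EuclideanSpace ℝ (Fin d) => ∑ i, y i := by fun_prop
    have : {y : Fin n → EuclideanSpace ℝ (Fin d) |
        ∑ i, y i ∈ Metric.closedBall x (h * √d) ∧ ∀ i, ‖y i‖ ≤ s} =
        (fun y => ∑ i, y i) ⁻¹' Metric.closedBall x (h * √d) ∩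
          ⋂ i, (fun y : Fin n → EuclideanSpace ℝ (Fin d) => y i) ⁻¹' {x | ‖x‖ ≤ s} := by
      ext y; simp
    rw [this]
    exact (h1 measurableSet_closedBall).inter (MeasurableSet.iInter fun i =>
      (measurable_pi_apply i) (measurableSet_norm_le s))
  rw [← hmap, measureReal_def (P.map _),
    Measure.map_apply_of_aemeasurable (aemeasurable_pi_lambda _ hmeas) hU, ← measureReal_def]
  refine measureReal_mono fun ω hω => ⟨?_, fun i => ?_⟩
  · have h1 := norm_sub_le_of_mem_cell hh hω.1
    rw [partialSum, Finset.sum_range] at h1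
    simpa [dist_eq_norm] using h1
  · exact (norm_le_runningMax (fun i => X i ω) i.2).trans hω.2

end LocalLDP

open LocalLDP in
theorem propositionp (d : ℕ) (hd : 1 ≤ d) (α : ℝ) (hα₀ : 0 < α) (hα₂ : α ≤ 2)
    (F : Measure (EuclideanSpace ℝ (Fin d))) [IsProbabilityMeasure F]
    (hF : InDomainOfAttractionWithoutCentering α F)
    (A : ℝ → ℝ) (hA : IsScalingFunction F A) :
    ∃ s₀ C : ℝ, 0 < s₀ ∧ 0 < C ∧ ∀ h : ℝ, 0 < h → ∃ K : ℝ, 0 < K ∧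
      ∀ (Ω : Type*) [MeasurableSpace Ω] (P : Measure Ω) [IsProbabilityMeasure P]
        (X : ℕ → Ω → EuclideanSpace ℝ (Fin d)),
        iIndepFun X P → (∀ i, HasLaw (X i) F P) →
        (∀ (x : EuclideanSpace ℝ (Fin d)) (s : ℝ), s₀ ≤ s → ∀ n : ℕ,
          P.real {ω | partialSum (fun i => X i ω) n ∈ cell x h ∧
              runningMax (fun i => X i ω) n ≤ s} ≤
            K * ((s ^ (-(d : ℤ)) + scalingSeq A n ^ (-(d : ℤ))) *
              Real.exp (-‖x‖ / s + C * n / A s))) ∧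
        ∀ n : ℕ, levyConcentration P (fun ω => partialSum (fun i => X i ω) n) h ≤
          K * scalingSeq A n ^ (-(d : ℤ)) := by
  obtain ⟨C, s₀, hC, hs₀, hmain⟩ := hF.exists_tiltedSum_le hd hα₀ hA
  refine ⟨s₀, C, hs₀, hC, fun h hh => ?_⟩
  have hd0 : (0 : ℝ) < d := by exact_mod_cast hd
  set ρ : ℝ := h * √d with hρ
  have hρ0 : 0 < ρ := by positivity
  obtain ⟨K, hK, hbound⟩ := hmain ρ hρ0
  refine ⟨Real.exp (ρ / s₀) * (K + 1), by positivity, fun Ω _ P _ X hind hlaw => ?_⟩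
  have hlocal : ∀ (x : EuclideanSpace ℝ (Fin d)) (s : ℝ), s₀ ≤ s → ∀ n : ℕ,
      P.real {ω | partialSum (fun i => X i ω) n ∈ cell x h ∧
          runningMax (fun i => X i ω) n ≤ s} ≤
        Real.exp (ρ / s₀) * (K + 1) * ((s ^ (-(d : ℤ)) + scalingSeq A n ^ (-(d : ℤ))) *
          Real.exp (-‖x‖ / s + C * n / A s)) := by
    intro x s hs n
    have hs0 : 0 < s := hs₀.trans_le hs
    have hsd0 : 0 < s ^ (-(d : ℤ)) := zpow_pos hs0 _
    have had0 : 0 < scalingSeq A n ^ (-(d : ℤ)) := zpow_pos (hA.scalingSeq_pos n) _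
    have hexp : Real.exp ((ρ - ‖x‖) / s) ≤ Real.exp (ρ / s₀) * Real.exp (-‖x‖ / s) := by
      rw [← Real.exp_add, Real.exp_le_exp, sub_div, neg_div, ← sub_eq_add_neg]
      gcongr
    rcases eq_or_ne n 0 with rfl | hn
    · by_cases h0 : (0 : EuclideanSpace ℝ (Fin d)) ∈ cell x h
      · have hx : ‖x‖ ≤ ρ := by simpa using norm_sub_le_of_mem_cell hh.le h0
        have h1 : 1 ≤ Real.exp ((ρ - ‖x‖) / s) :=
          Real.one_le_exp (div_nonneg (by linarith) hs0.le)
        have h2 : scalingSeq A 0 ^ (-(d : ℤ)) = 1 := by simp [scalingSeq]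
        rw [h2, Nat.cast_zero, mul_zero, zero_div, add_zero]
        have h3 : (1 : ℝ) ≤ (K + 1) * (s ^ (-(d : ℤ)) + 1) := by nlinarith
        calc _ ≤ (1 : ℝ) := measureReal_le_one
          _ ≤ 1 * (Real.exp (ρ / s₀) * Real.exp (-‖x‖ / s)) := by
              rw [one_mul]; exact h1.trans hexp
          _ ≤ (K + 1) * (s ^ (-(d : ℤ)) + 1) * (Real.exp (ρ / s₀) * Real.exp (-‖x‖ / s)) :=
              mul_le_mul_of_nonneg_right h3 (by positivity)
          _ = _ := by ring
      · have hempty : {ω | partialSum (fun i => X i ω) 0 ∈ cell x h ∧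
            runningMax (fun i => X i ω) 0 ≤ s} = ∅ := by
          ext ω; simp [partialSum, h0]
        rw [hempty, measureReal_empty]
        positivity
    · obtain ⟨u, hu, hux⟩ := exists_inner_eq_norm x
      calc _ ≤ _ := measureReal_cell_le_pi hind hlaw x hh.le s n
        _ ≤ _ := measureReal_pi_le_tiltedSum hs0 hu hux n
        _ ≤ (Real.exp (ρ / s₀) * Real.exp (-‖x‖ / s)) *
            (K * ((s ^ (-(d : ℤ)) + scalingSeq A n ^ (-(d : ℤ))) * Real.exp (C * n / A s))) :=
            mul_le_mul hexp (hbound s u x n hs hu hn) measureReal_nonneg (by positivity)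
        _ ≤ (Real.exp (ρ / s₀) * Real.exp (-‖x‖ / s)) * ((K + 1) *
            ((s ^ (-(d : ℤ)) + scalingSeq A n ^ (-(d : ℤ))) * Real.exp (C * n / A s))) := by
            gcongr
            linarith
        _ = _ := by rw [Real.exp_add]; ring
  refine ⟨hlocal, fun n => ciSup_le fun x => ?_⟩
  -- The truncation is removed by letting its level tend to infinity along the integers.
  have hmono : Monotone fun k : ℕ => {ω | partialSum (fun i => X i ω) n ∈ cell x h ∧
      runningMax (fun i => X i ω) n ≤ k} := fun k l hkl ω hω =>
    ⟨hω.1, hω.2.trans (by exact_mod_cast hkl)⟩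
  have hunion : ⋃ k : ℕ, {ω | partialSum (fun i => X i ω) n ∈ cell x h ∧
      runningMax (fun i => X i ω) n ≤ k} = {ω | partialSum (fun i => X i ω) n ∈ cell x h} := by
    ext ω
    simp only [mem_iUnion, mem_ofPred_eq, exists_and_left, and_iff_left_iff_imp]
    exact fun _ => exists_nat_ge _
  have hleft : Tendsto (fun k : ℕ => P.real {ω | partialSum (fun i => X i ω) n ∈ cell x h ∧
      runningMax (fun i => X i ω) n ≤ k}) atTop
      (𝓝 (P.real {ω | partialSum (fun i => X i ω) n ∈ cell x h})) := by
    have := tendsto_measure_iUnion_atTop (μ := P) hmono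
    rw [hunion] at this
    exact (ENNReal.tendsto_toReal (measure_ne_top _ _)).comp this
  have hright : Tendsto (fun s : ℝ => Real.exp (ρ / s₀) * (K + 1) *
      ((s ^ (-(d : ℤ)) + scalingSeq A n ^ (-(d : ℤ))) * Real.exp (-‖x‖ / s + C * n / A s))) atTop
      (𝓝 (Real.exp (ρ / s₀) * (K + 1) * ((0 + scalingSeq A n ^ (-(d : ℤ))) *
        Real.exp (0 + 0)))) := by
    have h1 : Tendsto (fun s : ℝ => s ^ (-(d : ℤ))) atTop (𝓝 0) :=
      tendsto_pow_neg_atTop (by omega)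
    have h2 : Tendsto (fun s : ℝ => -‖x‖ / s) atTop (𝓝 0) := tendsto_const_nhds.div_atTop tendsto_id
    have h3 : Tendsto (fun s : ℝ => C * n / A s) atTop (𝓝 0) :=
      tendsto_const_nhds.div_atTop hA.tendsto_atTop
    exact (((h1.add_const _).mul ((Real.continuous_exp.tendsto _).comp (h2.add h3)))).const_mul _
  have hle := le_of_tendsto_of_tendsto hleft (hright.comp tendsto_natCast_atTop_atTop)
    ((tendsto_natCast_atTop_atTop.eventually_ge_atTop s₀).mono fun k hk => hlocal x k hk n)
  simpa using hle
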